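/- **Notation.** For $a,b\in\mathbb R^d$ and $f\in L^2(\mathbb R^d)$ let $T_af(x)=f(x-a)$, $M_bf(x)=e^{2\pi i\langle b,x\rangle}f(x)$, and let $\hat f$ be the Fourier transform of $f$, extending $\hat f(\omega)=\int f(x)e^{-2\pi i\langle\omega,x\rangle}dx$. Identify $\mathbb Z^d/2\mathbb Z^d$ with $\{0,1\}^d$. For $\sigma\in\mathbb Z^d/2\mathbb Z^d$ let $\operatorname{supp}\sigma=\{i:\sigma_i\equiv1 \bmod 2\}$ and $R_\sigma x=((-1)^{\sigma_1}x_1,\dots,(-1)^{\sigma_d}x_d)$. Let $G\subset\mathbb Z^d/2\mathbb Z^d$ be a *separable* subgroup with $k$ generators: $G$ is generated by non-zero elements $\sigma^1,\dots,\sigma^k$ with pairwise disjoint supports $S_i=\operatorname{supp}\sigma^i$ (so $|G|=2^k$). Put $S_0=\{1,\dots,d\}\setminus\bigcup_{i\ge1}S_i$, $\operatorname{orbit}(x)=\{R_\sigma x:\sigma\in G\}$, $$\Lambda=\bigcup_{\sigma\in G}(\sigma+2\mathbb Z^d),\qquad 2\Lambda^\perp=\{\alpha\in\mathbb Z^d:\langle\alpha,\mu\rangle\in2\mathbb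 Z\text{ for all }\mu\in\Lambda\}.$$ Identify the dual group $\widehat G$ with $\mathbb Z^d/2\Lambda^\perp$, the class of $\alpha$ being the character $\sigma\mapsto(-1)^{\langle\alpha,\sigma\rangle}$, and let $I:G\to\widehat G$ be the isomorphism with $\langle I(\sigma^i),\sigma^j\rangle\equiv\delta_{ij}\bmod 2$; elements of $\widehat G$ are identified with a fixed choice of coset representatives in $\mathbb Z^d$. Let $N\subset\mathbb Z^d$ satisfy $|N\cap\operatorname{orbit}(x)|=1$ for all $x\in\mathbb Z^d$, and set $c_\gamma=2^{-k}|\operatorname{orbit}(\gamma)|^{1/2}$. Let $g\in L^2(\mathbb R^d)$ be *separable with respect to $G$*, i.e. $g(x)=\prod_{i=0}^kg_i(x|_{S_i})$ for a.e. $x$ with functions $g_i:\mathbb R^{S_i}\to\mathbb C$, where $x|_{S_i}=(x_j)_{j\in S_i}$, and suppose that $\hat g(\omega)=\overline{\hat g(\omega)}$ for a.e. $\omega$. Consider the Gabor system $$\mathcal G(g,G)=\{T_\lambda M_\gamma g\}_{\lambda\in\frac12\Lambda,\ \gamma\in\mathbb Z^d}$$ and the Wilson system $$\mathcal W(g,G)=\Big\{T_\lambda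 T_{\frac12h}\,c_\gamma\sum_{\sigma\in G}(-1)^{\langle I(h)+\gamma,\sigma\rangle}M_{R_\sigma\gamma}g\Big\}_{\lambda\in\mathbb Z^d,\ h\in G,\ \gamma\in N},$$ where the indices $(\lambda,h,\gamma)$ for which this function is zero are disregarded. Both systems are regarded as indexed families. **Theorem.** (i) For every $b\in\mathbb R$, $\mathcal G(g,G)$ is a Bessel sequence with bound $b$ if and only if $\mathcal W(g,G)$ is a Bessel sequence with bound $2^{-k}b$. If either system is a Bessel sequence (and hence both are), their frame operators $S_{\mathcal G}f=\sum_{\phi\in\mathcal G(g,G)}\langle f,\phi\rangle\phi$ and $S_{\mathcal W}f=\sum_{\phi\in\mathcal W(g,G)}\langle f,\phi\rangle\phi$ are bounded operators on $L^2(\mathbb R^d)$, given by unconditionally convergent series, and $S_{\mathcal G}=2^kS_{\mathcal W}$. (ii) For all $a,b\in\mathbb R$, $\mathcal G(g,G)$ is a frame for $L^2(\mathbb R^d)$ with bounds $a$ and $b$ if and only if $\mathcal W(g,G)$ is a Riesz basis for $L^2(\mathbb R^d)$ with bounds $2^{-k}a$ and $2^{-k}b$. (iii) $\mathcal G(g,G)$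 is a tight frame for $L^2(\mathbb R^d)$ with frame bound $2^k$ if and only if $\mathcal W(g,G)$ is an orthonormal basis for $L^2(\mathbb R^d)$. (Bounds: Bessel bound $b$ means $\sum|\langle f,\phi\rangle|^2\le b\|f\|^2$ for all $f$; frame bounds $a,b$ mean $a>0$ and $a\|f\|^2\le\sum|\langle f,\phi\rangle|^2\le b\|f\|^2$ for all $f$; a tight frame with bound $a$ is a frame with bounds $a,a$; a Riesz basis with bounds $a,b$ is a family $(\phi_i)$ with dense span such that $a>0$ and $a\sum|c_i|^2\le\|\sum c_i\phi_i\|^2\le b\sum|c_i|^2$ for all finitely supported $(c_i)$.) -/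

import Mathlib

open scoped FourierTransform
open MeasureTheory

namespace WilsonSystems

noncomputable section

/-! ## Bessel sequences, frames, Riesz bases, frame operators -/

section FrameTheory

variable {ι H : Type*} [NormedAddCommGroup H] [InnerProductSpace ℂ H]

/-- `φ` is a Bessel sequence with bound `b`: `∑ |⟨f, φ i⟩|² ≤ b ‖f‖²` for all `f`. -/
def IsBessel (φ : ι → H) (b : ℝ) : Prop :=
  ∀ f : H, Summable (fun i => ‖inner ℂ (φ i) f‖ ^ 2) ∧
    ∑' i, ‖inner ℂ (φ i) f‖ ^ 2 ≤ b * ‖f‖ ^ 2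

/-- `φ` is a frame for `H` with (lower, upper) bounds `a`, `b`. A tight frame with bound `a` is a
frame with bounds `a`, `a`. -/
def IsFrame (φ : ι → H) (a b : ℝ) : Prop :=
  0 < a ∧ IsBessel φ b ∧ ∀ f : H, a * ‖f‖ ^ 2 ≤ ∑' i, ‖inner ℂ (φ i) f‖ ^ 2

/-- `φ` is a Riesz basis for `H` with (lower, upper) bounds `a`, `b`. -/
def IsRieszBasis (φ : ι → H) (a b : ℝ) : Prop :=
  0 < a ∧ (Submodule.span ℂ (Set.range φ)).topologicalClosure = ⊤ ∧
    ∀ c : ι →₀ ℂ,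
      a * (∑ i ∈ c.support, ‖c i‖ ^ 2) ≤ ‖∑ i ∈ c.support, c i • φ i‖ ^ 2 ∧
      ‖∑ i ∈ c.support, c i • φ i‖ ^ 2 ≤ b * (∑ i ∈ c.support, ‖c i‖ ^ 2)

/-- `φ` is an orthonormal basis (complete orthonormal system) of `H`. -/
def IsONB (φ : ι → H) : Prop :=
  Orthonormal ℂ φ ∧ (Submodule.span ℂ (Set.range φ)).topologicalClosure = ⊤

/-- `S` is the frame operator of `φ`: for every `f` the series `∑ ⟨f, φ i⟩ φ i` converges
unconditionally to `S f`. -/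
def IsFrameOperator (φ : ι → H) (S : H →L[ℂ] H) : Prop :=
  ∀ f : H, HasSum (fun i => inner ℂ (φ i) f • φ i) (S f)

end FrameTheory

/-! ## Translation and modulation on `L²(ℝᵈ)` -/

/-- The Hilbert space `L²(ℝᵈ)`. -/
abbrev L2 (d : ℕ) : Type := Lp (α := EuclideanSpace ℝ (Fin d)) ℂ 2 volume

variable {d k : ℕ}

/-- The translation `(T_a f)(x) = f (x - a)`. -/
def translateL2 (a : EuclideanSpace ℝ (Fin d)) (f : L2 d) : L2 d :=
  Lp.compMeasurePreserving (fun x => x - a) (measurePreserving_sub_right volume a) f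

theorem memLp_modulateL2 (b : EuclideanSpace ℝ (Fin d)) (f : L2 d) :
    MemLp (fun x => Complex.exp (2 * Real.pi * (inner ℝ b x : ℝ) * Complex.I) * f x) 2
      (volume : Measure (EuclideanSpace ℝ (Fin d))) := by
  have hc : Continuous fun x : EuclideanSpace ℝ (Fin d) =>
      Complex.exp (2 * Real.pi * (inner ℝ b x : ℝ) * Complex.I) := by fun_prop
  refine (Lp.memLp f).congr_norm (hc.aestronglyMeasurable.mul (Lp.memLp f).1) ?_
  refine Filter.Eventually.of_forall fun x => ?_
  have h := Complex.norm_exp_ofReal_mul_I (2 * Real.pi * (inner ℝ b x : ℝ))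
  push_cast at h
  rw [norm_mul, h, one_mul]

/-- The modulation `(M_b f)(x) = exp (2πi ⟨b, x⟩) f x`. -/
def modulateL2 (b : EuclideanSpace ℝ (Fin d)) (f : L2 d) : L2 d :=
  (memLp_modulateL2 b f).toLp _

/-- An integer vector as a point of `ℝᵈ`. -/
def realVec (n : Fin d → ℤ) : EuclideanSpace ℝ (Fin d) := WithLp.toLp 2 fun j => (n j : ℝ)

/-! ## Separable subgroups of `ℤᵈ/2ℤᵈ` (realised as `Fin d → ZMod 2`) -/

/-- The representative of `σ ∈ ℤᵈ/2ℤᵈ` in `{0,1}ᵈ`. -/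
def lift01 (σ : Fin d → ZMod 2) : Fin d → ℤ := fun j => ((σ j).val : ℤ)

/-- `G` is a separable group, with (non-zero, disjointly supported) generators `s`. -/
structure IsSeparableGroup (G : AddSubgroup (Fin d → ZMod 2)) (s : Fin k → Fin d → ZMod 2) : Prop where
  ne_zero : ∀ i, s i ≠ 0
  disjoint_support : ∀ i j, i ≠ j → Disjoint (Function.support (s i)) (Function.support (s j))
  closure_eq : AddSubgroup.closure (Set.range s) = G

/-- A function `g` is separable with respect to the group generated by `s`: with `S_i = supp (s i)`
and `S_0 = [d] ∖ ⋃ S_i`, it is (almost everywhere) a product of a function of the coordinates in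
`S_0` and functions of the coordinates in `S_i`. -/
def IsSeparableFun (s : Fin k → Fin d → ZMod 2) (g : EuclideanSpace ℝ (Fin d) → ℂ) : Prop :=
  ∃ (g₀ : ({j : Fin d // ∀ i, s i j = 0} → ℝ) → ℂ)
    (g' : (i : Fin k) → ({j : Fin d // s i j ≠ 0} → ℝ) → ℂ),
    ∀ᵐ x : EuclideanSpace ℝ (Fin d),
      g x = g₀ (fun j => x j) * ∏ i, g' i (fun j => x j)

/-- The lattice `Λ = ⋃_{σ ∈ G} (σ + 2ℤᵈ) ⊆ ℤᵈ`. -/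
def lattice (G : AddSubgroup (Fin d → ZMod 2)) : AddSubgroup (Fin d → ℤ) where
  carrier := {n | (fun j => (n j : ZMod 2)) ∈ G}
  zero_mem' := by
    have h : (fun j : Fin d => (((0 : Fin d → ℤ) j : ℤ) : ZMod 2)) = 0 := by ext; simp
    simp only [Set.mem_ofPred_eq, h, zero_mem]
  add_mem' {a b} ha hb := by
    have h : (fun j : Fin d => (((a + b) j : ℤ) : ZMod 2)) =
      (fun j => (a j : ZMod 2)) + fun j => (b j : ZMod 2) := by ext; simp
    simp only [Set.mem_ofPred_eq] at *
    rw [h]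
    exact add_mem ha hb
  neg_mem' {a} ha := by
    have h : (fun j : Fin d => (((-a) j : ℤ) : ZMod 2)) = -(fun j => (a j : ZMod 2)) := by
      ext; simp
    simp only [Set.mem_ofPred_eq] at *
    rw [h]
    exact neg_mem ha

/-- The lattice `2Λ^⊥`, where `Λ^⊥ = {ξ : ⟨ξ, μ⟩ ∈ ℤ for all μ ∈ Λ}`. Since `2ℤᵈ ⊆ Λ`, it consists
of the integer vectors `α` with `⟨α, μ⟩` even for all `μ ∈ Λ`. -/
def twoDual (G : AddSubgroup (Fin d → ZMod 2)) : AddSubgroup (Fin d → ℤ) where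
  carrier := {α | ∀ μ ∈ lattice G, Even (∑ j, α j * μ j)}
  zero_mem' := by simp
  add_mem' {a b} ha hb μ hμ := by
    simpa [add_mul, Finset.sum_add_distrib] using (ha μ hμ).add (hb μ hμ)
  neg_mem' {a} ha μ hμ := by
    simpa [neg_mul, Finset.sum_neg_distrib] using (ha μ hμ).neg

/-- The dual group `Ĝ`, identified with `ℤᵈ / 2Λ^⊥`: the class of `α` is the character
`σ ↦ (-1)^⟨α, σ⟩`. -/
abbrev DualGroup (G : AddSubgroup (Fin d → ZMod 2)) : Type := (Fin d → ℤ) ⧸ twoDual G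

/-- `n` is the chosen element `n_i ∈ S_i = supp (s i)` for some `i`, namely the least one. -/
def IsPivot (s : Fin k → Fin d → ZMod 2) (n : Fin d) : Prop :=
  ∃ i, IsLeast (Function.support (s i)) n

open Classical in
/-- The integer vector with entry `h_n ∈ {0,1}` at each chosen `n = n_i`, and `0` elsewhere. For
`h = ∑ c_i s_i` this is `∑ c_i δ_{n_i}`. -/
def pivotPart (s : Fin k → Fin d → ZMod 2) (h : Fin d → ZMod 2) : Fin d → ℤ :=
  fun n => if IsPivot s n then lift01 h n else 0

/-- The canonical homomorphism `I : G → Ĝ`, `s_i ↦ δ_{n_i} + 2Λ^⊥`. -/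
def dualHom (G : AddSubgroup (Fin d → ZMod 2)) (s : Fin k → Fin d → ZMod 2) :
    G →+ DualGroup G :=
  AddMonoidHom.mk' (fun h => QuotientAddGroup.mk (pivotPart s h)) <| by
    intro a b
    rw [← QuotientAddGroup.mk_add, QuotientAddGroup.eq]
    intro μ _
    refine Finset.even_sum _ fun j _ => Even.mul_right ?_ _
    rw [← ZMod.intCast_eq_zero_iff_even]
    by_cases hj : IsPivot s j
    · have h : ∀ x y : ZMod 2, y + x + (x + y) = 0 := by decide
      simpa [pivotPart, lift01, hj] using h _ _
    · simp [pivotPart, hj]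

/-- `I` satisfies `⟨I(s_i), s_j⟩ ≡ δ_{ij} mod 2`, for every representative `α` of `I(s_i)`. -/
theorem dualHom_pairing {G : AddSubgroup (Fin d → ZMod 2)} {s : Fin k → Fin d → ZMod 2}
    (hs : IsSeparableGroup G s) (i j : Fin k) (hi : s i ∈ G) (α : Fin d → ℤ)
    (hα : QuotientAddGroup.mk α = dualHom G s ⟨s i, hi⟩) :
    ((∑ n, α n * lift01 (s j) n : ℤ) : ZMod 2) = if i = j then 1 else 0 := by
  have hlift : ∀ σ : Fin d → ZMod 2, (fun n => ((lift01 σ n : ℤ) : ZMod 2)) = σ := by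
    intro σ; ext n; simp [lift01]
  have hj : lift01 (s j) ∈ lattice G := by
    change (fun n => ((lift01 (s j) n : ℤ) : ZMod 2)) ∈ G
    rw [hlift, ← hs.closure_eq]
    exact AddSubgroup.subset_closure ⟨j, rfl⟩
  have h1 : -α + pivotPart s (s i) ∈ twoDual G := QuotientAddGroup.eq.1 hα
  have h2 := (ZMod.intCast_eq_zero_iff_even).2 (h1 _ hj)
  have h3 : ((∑ n, α n * lift01 (s j) n : ℤ) : ZMod 2) =
      ((∑ n, pivotPart s (s i) n * lift01 (s j) n : ℤ) : ZMod 2) := by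
    have : (∑ n, (-α + pivotPart s (s i)) n * lift01 (s j) n) =
        ∑ n, pivotPart s (s i) n * lift01 (s j) n - ∑ n, α n * lift01 (s j) n := by
      rw [← Finset.sum_sub_distrib]
      exact Finset.sum_congr rfl fun n _ => by simp only [Pi.add_apply, Pi.neg_apply]; ring
    rw [this, Int.cast_sub, sub_eq_zero] at h2
    exact h2.symm
  have hdis : ∀ a b n, s a n ≠ 0 → s b n ≠ 0 → a = b := by
    intro a b n ha hb
    by_contra hab
    exact Set.disjoint_left.1 (hs.disjoint_support a b hab) ha hb
  rw [h3]
  push_cast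
  split_ifs with hij
  · subst hij
    obtain ⟨m, hm⟩ : ∃ m, IsLeast (Function.support (s i)) m := by
      have hne : (Function.support (s i)).Nonempty := Function.support_nonempty_iff.2 (hs.ne_zero i)
      obtain ⟨m, hm, hle⟩ := Set.exists_min_image _ id (Set.toFinite _) hne
      exact ⟨m, hm, hle⟩
    rw [Finset.sum_eq_single m]
    · have h01 : ∀ a : ZMod 2, a ≠ 0 → a * a = 1 := by decide
      have := h01 _ hm.1
      have hp : IsPivot s m := ⟨i, hm⟩
      simpa [pivotPart, lift01, hp] using this
    · intro n _ hn
      by_cases h0 : s i n = 0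
      · simp [lift01, h0]
      · have hp : ¬ IsPivot s n := by
          rintro ⟨b, hb⟩
          obtain rfl := hdis i b n h0 hb.1
          exact hn (hb.unique hm)
        simp [pivotPart, hp]
    · simp
  · refine Finset.sum_eq_zero fun n _ => ?_
    by_cases h0 : s i n = 0
    · simp [pivotPart, lift01, h0]
    · have : s j n = 0 := by
        by_contra hb
        exact hij (hdis i j n h0 hb)
      simp [lift01, this]

/-! ## Reflections, the Gabor system and the Wilson system -/

/-- The reflection `R_σ x = ((-1)^{σ_1} x_1, …, (-1)^{σ_d} x_d)`, on `ℤᵈ`. -/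
def reflect (σ : Fin d → ZMod 2) (x : Fin d → ℤ) : Fin d → ℤ :=
  fun j => (-1) ^ (σ j).val * x j

/-- The orbit of `x ∈ ℤᵈ` under the reflections `R_σ`, `σ ∈ G`. -/
def orbit (G : AddSubgroup (Fin d → ZMod 2)) (x : Fin d → ℤ) : Set (Fin d → ℤ) :=
  {y | ∃ σ ∈ G, y = reflect σ x}

/-- The Gabor system `{T_λ M_γ g}`, `λ ∈ ½Λ`, `γ ∈ ℤᵈ`; here `λ = ½μ` with `μ ∈ Λ`. -/
def gaborSystem (G : AddSubgroup (Fin d → ZMod 2)) (g : L2 d) :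
    lattice G × (Fin d → ℤ) → L2 d :=
  fun p => translateL2 ((1 / 2 : ℝ) • realVec (p.1 : Fin d → ℤ)) (modulateL2 (realVec p.2) g)

open Classical in
/-- The function `T_λ T_{h/2} c_γ ∑_{σ ∈ G} (-1)^{⟨I(h)+γ, σ⟩} M_{R_σ γ} g`, with
`c_γ = 2^{-k} |orbit γ|^{1/2}`. Here `rep` picks the coset representative of `I(h)` in `ℤᵈ`. -/
def wilsonFun (G : AddSubgroup (Fin d → ZMod 2)) (s : Fin k → Fin d → ZMod 2)
    (rep : DualGroup G → Fin d → ℤ) (g : L2 d) (l : Fin d → ℤ) (h : G) (γ : Fin d → ℤ) : L2 d :=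
  translateL2 (realVec l) <| translateL2 ((1 / 2 : ℝ) • realVec (lift01 (h : Fin d → ZMod 2))) <|
    (((2 : ℝ) ^ k)⁻¹ * √((orbit G γ).ncard : ℝ) : ℝ) •
      ∑ σ : G, ((-1 : ℂ) ^ (∑ j, (rep (dualHom G s h) j + γ j) * lift01 (σ : Fin d → ZMod 2) j)) •
        modulateL2 (realVec (reflect (σ : Fin d → ZMod 2) γ)) g

/-- The Wilson system: the functions `wilsonFun` for `λ ∈ ℤᵈ`, `h ∈ G`, `γ ∈ N`, where the indices
whose function vanishes identically are disregarded. -/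
def wilsonSystem (G : AddSubgroup (Fin d → ZMod 2)) (s : Fin k → Fin d → ZMod 2)
    (rep : DualGroup G → Fin d → ℤ) (N : Set (Fin d → ℤ)) (g : L2 d) :
    {p : (Fin d → ℤ) × G × N // wilsonFun G s rep g p.1 p.2.1 p.2.2 ≠ 0} → L2 d :=
  fun p => wilsonFun G s rep g p.1.1 p.1.2.1 p.1.2.2

end

end WilsonSystems

open WilsonSystems

/-!
The theorem rests on one energy identity. Write `π(μ, γ) = T_{μ/2} M_γ` for `μ ∈ Λ` and `γ ∈ ℤᵈ`.
Expanding the square of a Wilson coefficient and summing over all indices gives `2⁻ᵏ` times the sum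
over `σ ∈ G` of
`Q_σ(f) = ∑_{μ, γ} (-1)^⟨I(h)+γ, σ⟩ ⟨f, π(μ, γ) g⟩ conj ⟨f, π(μ, R_σ γ) g⟩`, `h = μ mod 2`.
The term `Q_0` is the Gabor energy of `f`, and `Q_σ(f) = 0` for `σ ≠ 0` (`hasSum_crossTerm`), whence
`hasSum_wilson_sq`.

The cancellation takes place in the time domain. For `f` bounded with bounded support, Parseval's
identity in `γ` (`hasSum_fcoef_mul_conj`) turns `Q_σ(f)` into an absolutely convergent sum over
`(μ, n) ∈ Λ × ℤᵈ` of a sign `±1` times the integral `correlation`, in which `g` enters through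
`conj (g y) * g v` with `v = R_σ(y + n) + σ/2`. The Fourier transform of `g` is real, so that
`g v = conj (g (-v))` (`neg_eq_conj_of_fourier_real`), and `g` enters through `g y * g (-v)`. If the
generator `s i` occurs in `σ`, then exchanging the coordinates of `y` and `-v` in the block
`supp (s i)` is a translation in `y`, compensated in the arguments of `f` by an involution of
`(μ, n)` that adds `s i` to `μ` modulo `2`. Separability makes the integral invariant
(`correlation_swap`), while `⟨I(s i), σ⟩` is odd, so the sign changes and the sum equals its own
negative.

Since test functions are dense, the identity yields the comparison of Bessel bounds, frame bounds
and frame operators (`IsEnergyScaled`). What remains is that a Wilson frame is a Riesz basis. By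
`IsFrame.isRieszBasis` it suffices that each element has inner product `1` with its canonical dual,
because the dual coefficients of that element then have total energy `1`, concentrated at one index.
The Gabor frame operator `S` commutes with the shifts `π(μ, γ)`, so the canonical dual of a Wilson
element is `2ᵏ` times the corresponding Wilson function of the window `S⁻¹ g`. The inner product
is computed from `⟨M_β g, S⁻¹ g⟩ = 2⁻ᵏ δ_{β, 0}` for `β ∈ 2ℤᵈ` (`inner_modulate_dual`), which
follows by testing the reconstruction formula on the indicator function of the unit cube, whose
integer time-frequency shifts form an orthonormal basis. Orbit counting then gives the value `1`
(`inner_wilsonFun_dual`).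
-/

namespace WilsonSystems

open scoped ComplexConjugate ENNReal

/-! ### Bessel sequences, frames and Riesz bases in a Hilbert space -/

section AbstractFrames

variable {ι H : Type*} [NormedAddCommGroup H] [InnerProductSpace ℂ H]

theorem IsBessel.bound_nonneg [Nontrivial H] {φ : ι → H} {b : ℝ} (h : IsBessel φ b) : 0 ≤ b := by
  obtain ⟨f, hf⟩ := exists_ne (0 : H)
  have h1 : 0 ≤ b * ‖f‖ ^ 2 := (tsum_nonneg fun i => by positivity).trans (h f).2
  have h2 : 0 < ‖f‖ ^ 2 := by positivity
  exact nonneg_of_mul_nonneg_left h1 h2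

theorem norm_sum_inner_sq_le (φ : ι → H) (c : ι → ℂ) (F : Finset ι) (y : H) :
    ‖inner ℂ (∑ i ∈ F, c i • φ i) y‖ ^ 2 ≤
      (∑ i ∈ F, ‖c i‖ ^ 2) * ∑ i ∈ F, ‖inner ℂ (φ i) y‖ ^ 2 := by
  have h1 : ‖inner ℂ (∑ i ∈ F, c i • φ i) y‖ ≤ ∑ i ∈ F, ‖c i‖ * ‖inner ℂ (φ i) y‖ := by
    rw [sum_inner]
    refine (norm_sum_le _ _).trans (Finset.sum_le_sum fun i _ => ?_)
    rw [inner_smul_left, norm_mul, RCLike.norm_conj]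
  calc _ ≤ (∑ i ∈ F, ‖c i‖ * ‖inner ℂ (φ i) y‖) ^ 2 := by gcongr
    _ ≤ _ := Finset.sum_mul_sq_le_sq_mul_sq _ _ _

/-- The synthesis operator of a Bessel sequence has the same bound as the analysis operator. -/
theorem IsBessel.norm_sum_sq_le {φ : ι → H} {b : ℝ} (hb : 0 ≤ b) (h : IsBessel φ b) (c : ι → ℂ)
    (F : Finset ι) : ‖∑ i ∈ F, c i • φ i‖ ^ 2 ≤ b * ∑ i ∈ F, ‖c i‖ ^ 2 := by
  set y := ∑ i ∈ F, c i • φ i with hy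
  have hC : 0 ≤ ∑ i ∈ F, ‖c i‖ ^ 2 := Finset.sum_nonneg fun i _ => by positivity
  rcases eq_or_ne y 0 with h0 | h0
  · rw [h0]; simp; positivity
  have h1 := norm_sum_inner_sq_le φ c F y
  rw [← hy] at h1
  have h2 : ∑ i ∈ F, ‖inner ℂ (φ i) y‖ ^ 2 ≤ b * ‖y‖ ^ 2 :=
    ((h y).1.sum_le_tsum F fun i _ => by positivity).trans (h y).2
  have h3 : ‖inner ℂ y y‖ = ‖y‖ ^ 2 := by
    rw [inner_self_eq_norm_sq_to_K]; simp
  rw [h3] at h1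
  have h4 : 0 < ‖y‖ ^ 2 := by positivity
  have h5 := h1.trans (mul_le_mul_of_nonneg_left h2 hC)
  nlinarith

theorem IsBessel.summable_smul [CompleteSpace H] {φ : ι → H} {b : ℝ} (hb : 0 ≤ b)
    (h : IsBessel φ b) (c : ι → ℂ) (hc : Summable fun i => ‖c i‖ ^ 2) :
    Summable fun i => c i • φ i := by
  rw [summable_iff_vanishing_norm]
  intro ε hε
  obtain ⟨s, hs⟩ := summable_iff_vanishing_norm.1 hc (ε ^ 2 / (b + 1)) (by positivity)
  refine ⟨s, fun t ht => ?_⟩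
  have h1 := h.norm_sum_sq_le hb c t
  have h2 := hs t ht
  rw [Real.norm_of_nonneg (Finset.sum_nonneg fun i _ => by positivity),
    lt_div_iff₀ (by positivity)] at h2
  have h3 : 0 ≤ ∑ i ∈ t, ‖c i‖ ^ 2 := Finset.sum_nonneg fun i _ => by positivity
  refine lt_of_pow_lt_pow_left₀ 2 hε.le ?_
  nlinarith

theorem IsBessel.exists_frameOperator [CompleteSpace H] [Nontrivial H] {φ : ι → H} {b : ℝ}
    (h : IsBessel φ b) : ∃ S : H →L[ℂ] H, IsFrameOperator φ S := by
  have hb := h.bound_nonneg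
  have hs : ∀ f, Summable fun i => inner ℂ (φ i) f • φ i := fun f =>
    h.summable_smul hb _ (h f).1
  let L : H →ₗ[ℂ] H :=
    { toFun := fun f => ∑' i, inner ℂ (φ i) f • φ i
      map_add' := fun f g => by
        rw [← (hs f).tsum_add (hs g)]
        exact tsum_congr fun i => by rw [inner_add_right, add_smul]
      map_smul' := fun c f => by
        rw [RingHom.id_apply, ← (hs f).tsum_const_smul c]
        exact tsum_congr fun i => by rw [inner_smul_right, mul_smul] }
  have hL : ∀ f, ‖L f‖ ≤ b * ‖f‖ := by
    intro f
    have h1 : Filter.Tendsto (fun F : Finset ι => ‖∑ i ∈ F, inner ℂ (φ i) f • φ i‖)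
        Filter.atTop (nhds ‖L f‖) := (hs f).hasSum.norm
    refine le_of_tendsto h1 (Filter.Eventually.of_forall fun F => ?_)
    have h2 := h.norm_sum_sq_le hb (fun i => inner ℂ (φ i) f) F
    have h3 := ((h f).1.sum_le_tsum F fun i _ => by positivity).trans (h f).2
    refine le_of_sq_le_sq ?_ (by positivity)
    nlinarith [mul_le_mul_of_nonneg_left h3 hb]
  exact ⟨L.mkContinuous b hL, fun f => (hs f).hasSum⟩

theorem IsFrameOperator.hasSum_inner {φ : ι → H} {S : H →L[ℂ] H} (hS : IsFrameOperator φ S)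
    (f x : H) : HasSum (fun i => inner ℂ (φ i) f * inner ℂ x (φ i)) (inner ℂ x (S f)) := by
  have := (hS f).mapL (innerSL ℂ x)
  simpa [inner_smul_right] using this

theorem IsFrameOperator.hasSum_norm_sq {φ : ι → H} {S : H →L[ℂ] H} (hS : IsFrameOperator φ S)
    (f : H) : HasSum (fun i => ‖inner ℂ (φ i) f‖ ^ 2) (inner ℂ f (S f)).re := by
  have := Complex.hasSum_re (hS.hasSum_inner f f)
  refine this.congr_fun fun i => ?_
  rw [← inner_conj_symm f (φ i), Complex.mul_conj, Complex.ofReal_re, Complex.normSq_eq_norm_sq]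

theorem IsFrameOperator.inner_left {φ : ι → H} {S : H →L[ℂ] H} (hS : IsFrameOperator φ S)
    (f x : H) : inner ℂ (S x) f = inner ℂ x (S f) := by
  have h1 := hS.hasSum_inner f x
  have h2 := Complex.hasSum_conj'.2 (hS.hasSum_inner x f)
  rw [inner_conj_symm] at h2
  refine h2.unique (h1.congr_fun fun i => ?_)
  rw [map_mul, inner_conj_symm, inner_conj_symm, mul_comm]

/-- A Bessel bound need only be verified on a dense set of vectors. -/
theorem IsBessel.of_dense {φ : ι → H} {b : ℝ} {D : Set H} (hD : Dense D)
    (h : ∀ f ∈ D, Summable (fun i => ‖inner ℂ (φ i) f‖ ^ 2) ∧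
      ∑' i, ‖inner ℂ (φ i) f‖ ^ 2 ≤ b * ‖f‖ ^ 2) : IsBessel φ b := by
  have key : ∀ (F : Finset ι) (f : H), ∑ i ∈ F, ‖inner ℂ (φ i) f‖ ^ 2 ≤ b * ‖f‖ ^ 2 := by
    intro F f
    have hcl : IsClosed {f : H | ∑ i ∈ F, ‖inner ℂ (φ i) f‖ ^ 2 ≤ b * ‖f‖ ^ 2} :=
      isClosed_le (by fun_prop) (by fun_prop)
    have : closure D ⊆ {f : H | ∑ i ∈ F, ‖inner ℂ (φ i) f‖ ^ 2 ≤ b * ‖f‖ ^ 2} :=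
      closure_minimal (fun f hf =>
        ((h f hf).1.sum_le_tsum F fun i _ => by positivity).trans (h f hf).2) hcl
    exact this (hD f)
  intro f
  have hs := summable_of_sum_le (fun i => by positivity) (fun F => key F f)
  exact ⟨hs, hs.tsum_le_of_sum_le fun F => key F f⟩

/-- The lower bound is checked on the span, where `f = ∑ cᵢ φᵢ` gives
`‖f‖⁴ ≤ (∑ |cᵢ|²) (∑ |⟨φᵢ, f⟩|²)`, and extended by density. -/
theorem IsRieszBasis.isFrame [CompleteSpace H] [Nontrivial H] {φ : ι → H} {a b : ℝ}
    (h : IsRieszBasis φ a b) : IsFrame φ a b := by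
  obtain ⟨ha, hspan, hc⟩ := h
  have hc' : ∀ (F : Finset ι) (c : ι → ℂ), a * (∑ i ∈ F, ‖c i‖ ^ 2) ≤ ‖∑ i ∈ F, c i • φ i‖ ^ 2 ∧
      ‖∑ i ∈ F, c i • φ i‖ ^ 2 ≤ b * (∑ i ∈ F, ‖c i‖ ^ 2) := by
    classical
    intro F c
    have h1 := hc (Finsupp.indicator F fun i _ => c i)
    have hsub := Finsupp.support_indicator_subset (f := fun i _ => c i) (s := F)
    rw [Finset.sum_subset (s₂ := F) hsub (fun i _ hi => by simp [Finsupp.notMem_support_iff.1 hi]),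
      Finset.sum_subset (s₂ := F) hsub (fun i _ hi => by simp [Finsupp.notMem_support_iff.1 hi])]
      at h1
    have e : ∀ i ∈ F, (Finsupp.indicator F fun i _ => c i) i = c i := fun i hi => by
      simp [Finsupp.indicator_apply, hi]
    rwa [Finset.sum_congr rfl fun i hi => by rw [e i hi],
      Finset.sum_congr (g := fun i => c i • φ i) rfl fun i hi => by rw [e i hi]] at h1
  -- the bound `b` is positive, because some basis vector exists
  have hb : 0 < b := by
    have : Nonempty ι := by
      by_contra hne
      rw [not_nonempty_iff] at hne
      obtain ⟨f, hf⟩ := exists_ne (0 : H)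
      have : f ∈ (Submodule.span ℂ (Set.range φ)).topologicalClosure := hspan ▸ Submodule.mem_top
      rw [Set.range_eq_empty, Submodule.span_empty] at this
      rw [← SetLike.mem_coe, Submodule.topologicalClosure_coe] at this
      simp at this
      exact hf this
    obtain ⟨i⟩ := this
    have h1 := hc' {i} fun _ => 1
    simp at h1
    linarith
  have hBessel : IsBessel φ b := by
    refine IsBessel.of_dense dense_univ fun f _ => ?_
    have key : ∀ F : Finset ι, ∑ i ∈ F, ‖inner ℂ (φ i) f‖ ^ 2 ≤ b * ‖f‖ ^ 2 := by
      intro F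
      set A := ∑ i ∈ F, ‖inner ℂ (φ i) f‖ ^ 2 with hA
      have hA0 : 0 ≤ A := Finset.sum_nonneg fun i _ => by positivity
      have h1 := (hc' F fun i => inner ℂ (φ i) f).2
      have h2 : inner ℂ (∑ i ∈ F, inner ℂ (φ i) f • φ i) f = (A : ℂ) := by
        rw [sum_inner, hA, Complex.ofReal_sum]
        refine Finset.sum_congr rfl fun i _ => ?_
        rw [inner_smul_left, Complex.conj_mul', Complex.ofReal_pow]
      have h3 := norm_inner_le_norm (𝕜 := ℂ) (∑ i ∈ F, inner ℂ (φ i) f • φ i) f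
      rw [h2, Complex.norm_real, Real.norm_of_nonneg hA0] at h3
      have h4 : A ^ 2 ≤ b * A * ‖f‖ ^ 2 := by
        calc A ^ 2 ≤ (‖∑ i ∈ F, inner ℂ (φ i) f • φ i‖ * ‖f‖) ^ 2 := by gcongr
          _ = ‖∑ i ∈ F, inner ℂ (φ i) f • φ i‖ ^ 2 * ‖f‖ ^ 2 := by ring
          _ ≤ _ := by gcongr
      rcases hA0.eq_or_lt with h0 | h0
      · rw [← h0]; positivity
      · nlinarith
    have hs := summable_of_sum_le (fun i => by positivity) key
    exact ⟨hs, hs.tsum_le_of_sum_le key⟩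
  refine ⟨ha, hBessel, ?_⟩
  obtain ⟨S, hS⟩ := hBessel.exists_frameOperator
  simp_rw [fun f => (hS.hasSum_norm_sq f).tsum_eq]
  intro f
  have hcl : IsClosed {f : H | a * ‖f‖ ^ 2 ≤ (inner ℂ f (S f)).re} :=
    isClosed_le (by fun_prop) (by fun_prop)
  have hsub : ((Submodule.span ℂ (Set.range φ) : Submodule ℂ H) : Set H) ⊆
      {f : H | a * ‖f‖ ^ 2 ≤ (inner ℂ f (S f)).re} := by
    intro f hf
    obtain ⟨c, rfl⟩ := (Finsupp.mem_span_range_iff_exists_finsupp).1 hf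
    set f := c.sum fun i a => a • φ i with hf'
    change a * ‖f‖ ^ 2 ≤ (inner ℂ f (S f)).re
    rw [← (hS.hasSum_norm_sq f).tsum_eq]
    rcases eq_or_ne f 0 with h0 | h0
    · rw [h0]; simp
    have h1 := (hc c).1
    have h2 := norm_sum_inner_sq_le φ c c.support f
    have h3 : ∑ i ∈ c.support, c i • φ i = f := rfl
    rw [h3] at h1 h2
    rw [inner_self_eq_norm_sq_to_K] at h2
    have h5 : ∑ i ∈ c.support, ‖inner ℂ (φ i) f‖ ^ 2 ≤ ∑' i, ‖inner ℂ (φ i) f‖ ^ 2 :=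
      (hS.hasSum_norm_sq f).summable.sum_le_tsum _ fun i _ => by positivity
    set A := ∑ i ∈ c.support, ‖inner ℂ (φ i) f‖ ^ 2
    set B := ∑ i ∈ c.support, ‖c i‖ ^ 2
    simp at h2
    have hA : 0 ≤ A := Finset.sum_nonneg fun i _ => by positivity
    have h4 : 0 < ‖f‖ ^ 2 := by positivity
    have : a * (‖f‖ ^ 2) ^ 2 ≤ ‖f‖ ^ 2 * A := by
      calc a * (‖f‖ ^ 2) ^ 2 ≤ a * (B * A) := by gcongr
        _ = (a * B) * A := by ring
        _ ≤ _ := by gcongr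
    nlinarith
  have hdense : f ∈ closure ((Submodule.span ℂ (Set.range φ) : Submodule ℂ H) : Set H) := by
    rw [← Submodule.topologicalClosure_coe, hspan]; trivial
  exact closure_minimal hsub hcl hdense

/-- A frame whose canonical dual `x` satisfies `⟨φ i, x i⟩ = 1` for every `i` is a Riesz basis. The
normalisation forces biorthogonality: `∑ⱼ |⟨φ j, x i⟩|² = ⟨S x i, x i⟩ = 1`, and the term `j = i`
is already `1`. -/
theorem IsFrame.isRieszBasis [CompleteSpace H] [Nontrivial H] {φ : ι → H} {a b : ℝ}
    (h : IsFrame φ a b) {S : H →L[ℂ] H} (hS : IsFrameOperator φ S) (x : ι → H)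
    (hx : ∀ i, S (x i) = φ i) (hx1 : ∀ i, inner ℂ (φ i) (x i) = 1) : IsRieszBasis φ a b := by
  classical
  obtain ⟨ha, hB, hlow⟩ := h
  have hbi : ∀ i j, inner ℂ (φ j) (x i) = if j = i then 1 else 0 := by
    intro i j
    split_ifs with hij
    · rw [hij, hx1]
    have h1 := hS.hasSum_norm_sq (x i)
    rw [hx, ← inner_conj_symm, hx1] at h1
    simp only [map_one, Complex.one_re] at h1
    have h2 := h1.summable.sum_le_tsum {i, j} fun i _ => by positivity
    rw [h1.tsum_eq, Finset.sum_pair (Ne.symm hij), hx1] at h2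
    simpa using h2
  refine ⟨ha, ?_, fun c => ⟨?_, hB.norm_sum_sq_le hB.bound_nonneg c _⟩⟩
  · rw [Submodule.topologicalClosure_eq_top_iff, Submodule.eq_bot_iff]
    intro f hf
    have h0 : ∀ i, inner ℂ (φ i) f = 0 := fun i =>
      (Submodule.mem_orthogonal _ _).1 hf _ (Submodule.subset_span ⟨i, rfl⟩)
    have h1 := hlow f
    simp [h0] at h1
    by_contra hne
    have : 0 < ‖f‖ ^ 2 := by positivity
    nlinarith
  · set y := ∑ i ∈ c.support, c i • φ i with hy
    set z := ∑ i ∈ c.support, c i • x i with hz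
    set B := ∑ i ∈ c.support, ‖c i‖ ^ 2 with hBdef
    have hB0 : 0 ≤ B := Finset.sum_nonneg fun i _ => by positivity
    have hSz : S z = y := by simp [hz, hy, map_sum, hx]
    have hin : ∀ j, inner ℂ (φ j) z = c j := by
      intro j
      rw [hz, inner_sum]
      simp_rw [inner_smul_right, hbi]
      simp +contextual [eq_comm]
    have h1 := hS.hasSum_norm_sq z
    simp_rw [hin, hSz] at h1
    have h2 : HasSum (fun i => ‖c i‖ ^ 2) B := hasSum_sum_of_ne_finset_zero fun i hi => by
      simp [Finsupp.notMem_support_iff.1 hi]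
    have h3 := hlow z
    simp_rw [hin] at h3
    rw [h2.tsum_eq] at h3
    have h4 : B ≤ ‖z‖ * ‖y‖ := by
      rw [h2.unique h1]
      exact (Complex.re_le_norm _).trans (norm_inner_le_norm z y)
    rcases hB0.eq_or_lt with h0 | h0
    · rw [← h0]; simp
    · have h5 : a * B * B ≤ ‖y‖ ^ 2 * B := by
        calc a * B * B = a * B ^ 2 := by ring
          _ ≤ a * (‖z‖ * ‖y‖) ^ 2 := by gcongr
          _ = (a * ‖z‖ ^ 2) * ‖y‖ ^ 2 := by ring
          _ ≤ B * ‖y‖ ^ 2 := by gcongr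
          _ = _ := by ring
      exact le_of_mul_le_mul_right h5 h0

theorem IsFrame.frameOperator_surjective [CompleteSpace H] {φ : ι → H} {a b : ℝ}
    (h : IsFrame φ a b) {S : H →L[ℂ] H} (hS : IsFrameOperator φ S) : Function.Surjective S := by
  have hu : IsUnit S := by
    refine S.isUnit_of_forall_le_norm_inner_map (c := ⟨a, h.1.le⟩) h.1 fun f => ?_
    have h1 := h.2.2 f
    rw [(hS.hasSum_norm_sq f).tsum_eq] at h1
    rw [hS.inner_left]
    refine le_trans (le_of_eq_of_le ?_ h1) (Complex.re_le_norm _)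
    change ‖f‖ ^ 2 * a = _
    ring
  obtain ⟨u, rfl⟩ := hu
  intro y
  exact ⟨(↑u⁻¹ : H →L[ℂ] H) y, by
    rw [← mul_apply_eq_comp, Units.mul_inv]; rfl⟩

theorem isRieszBasis_one_iff_isONB (φ : ι → H) : IsRieszBasis φ 1 1 ↔ IsONB φ := by
  classical
  constructor
  · rintro ⟨-, hs, hc⟩
    refine ⟨?_, hs⟩
    have hn : ∀ c : ι →₀ ℂ, ‖Finsupp.linearCombination ℂ φ c‖ ^ 2 = ∑ i ∈ c.support, ‖c i‖ ^ 2 :=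
      fun c => by
        have := hc c
        rw [one_mul] at this
        exact le_antisymm this.2 this.1
    rw [orthonormal_iff_ite]
    have h1 : ∀ i, ‖φ i‖ = 1 := fun i => by
      have := hn (Finsupp.single i 1)
      rw [Finsupp.support_single _ (one_ne_zero (α := ℂ))] at this
      simp at this
      exact this.resolve_right fun h => by linarith [norm_nonneg (φ i)]
    intro i j
    split_ifs with hij
    · rw [hij, inner_self_eq_norm_sq_to_K, h1]; simp
    have h2 : ∀ z : ℂ, ‖φ i + z • φ j‖ ^ 2 = 1 + ‖z‖ ^ 2 := fun z => by
      rcases eq_or_ne z 0 with rfl | hz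
      · simp [h1]
      have := hn (Finsupp.single i 1 + Finsupp.single j z)
      rw [Finsupp.support_add_eq] at this
      · rw [Finsupp.support_single _ (one_ne_zero (α := ℂ)), Finsupp.support_single _ hz,
          Finset.sum_union (by simpa using hij)] at this
        simpa [hij, Ne.symm hij, Finsupp.single_apply] using this
      · rw [Finsupp.support_single _ (one_ne_zero (α := ℂ)), Finsupp.support_single _ hz]
        simpa using hij
    have h3 : ∀ z : ℂ, (z * inner ℂ (φ i) (φ j)).re = 0 := fun z => by
      have := h2 z
      rw [@norm_add_sq ℂ, norm_smul, h1, h1, inner_smul_right] at this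
      simp at this
      simpa using this
    have h4 := h3 1
    have h5 := h3 Complex.I
    apply Complex.ext <;> simp at h4 h5 ⊢
    · exact h4
    · exact h5
  · rintro ⟨ho, hs⟩
    refine ⟨one_pos, hs, fun c => ?_⟩
    have : ‖∑ i ∈ c.support, c i • φ i‖ ^ 2 = ∑ i ∈ c.support, ‖c i‖ ^ 2 := by
      have h1 := ho.inner_sum (fun i => c i) (fun i => c i) c.support
      rw [inner_self_eq_norm_sq_to_K] at h1
      simp only [Complex.conj_mul'] at h1
      exact Complex.ofReal_injective (by simpa using h1)
    rw [one_mul, this]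
    exact ⟨le_rfl, le_rfl⟩

end AbstractFrames

/-! ### Parseval's identity on the unit cube -/

section Parseval

variable {d : ℕ}

/-- The half-open unit cube `(0, 1]ᵈ`. -/
def unitCube (d : ℕ) : Set (EuclideanSpace ℝ (Fin d)) := {x | ∀ i, x i ∈ Set.Ioc (0 : ℝ) 1}

theorem measurableSet_unitCube : MeasurableSet (unitCube d) := by
  have : unitCube d = ⋂ i, (fun x : EuclideanSpace ℝ (Fin d) => x i) ⁻¹' Set.Ioc (0 : ℝ) 1 := by
    ext; simp [unitCube]
  rw [this]
  exact MeasurableSet.iInter fun i =>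
    (by fun_prop : Measurable fun x : EuclideanSpace ℝ (Fin d) => x i) measurableSet_Ioc

/-- The Fourier transform of `p` at the integer point `γ`, i.e. the `γ`-th Fourier coefficient of
the `ℤᵈ`-periodisation of `p`. -/
noncomputable def fcoef (p : EuclideanSpace ℝ (Fin d) → ℂ) (γ : Fin d → ℤ) : ℂ :=
  ∫ y, Complex.exp (-(2 * Real.pi * (inner ℝ (realVec γ) y : ℝ) * Complex.I)) * p y

theorem continuous_phase (γ : Fin d → ℤ) : Continuous fun y : EuclideanSpace ℝ (Fin d) =>
    Complex.exp (-(2 * Real.pi * (inner ℝ (realVec γ) y : ℝ) * Complex.I)) := by fun_prop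

theorem norm_phase (γ : Fin d → ℤ) (y : EuclideanSpace ℝ (Fin d)) :
    ‖Complex.exp (-(2 * Real.pi * (inner ℝ (realVec γ) y : ℝ) * Complex.I))‖ = 1 := by
  have h := Complex.norm_exp_ofReal_mul_I (-(2 * Real.pi * (inner ℝ (realVec γ) y : ℝ)))
  push_cast at h
  rwa [neg_mul] at h

theorem inner_realVec (γ : Fin d → ℤ) (y : EuclideanSpace ℝ (Fin d)) :
    inner ℝ (realVec γ) y = ∑ i, (γ i : ℝ) * y i := by
  simp [realVec, PiLp.inner_apply, mul_comm]

/-- The Haar probability measure on the circle, the normalisation used for `UnitAddTorus`. -/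
noncomputable local instance : MeasureSpace UnitAddCircle := ⟨AddCircle.haarAddCircle⟩

/-- The representative in `(0, 1]ᵈ` of a point of the torus. -/
noncomputable def torusRep (t : UnitAddTorus (Fin d)) : EuclideanSpace ℝ (Fin d) :=
  WithLp.toLp 2 (UnitAddTorus.measurableEquivPiIoc (fun _ : Fin d => (0 : ℝ)) t).1

theorem measurePreserving_torusRep :
    MeasurePreserving (torusRep (d := d)) volume (volume.restrict (unitCube d)) := by
  have h1 := UnitAddTorus.measurePreserving_equivPiIoc (fun _ : Fin d => (0 : ℝ))
  have hm : MeasurableSet {x : Fin d → ℝ | ∀ i, x i ∈ Set.Ioc (0 : ℝ) (0 + 1)} :=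
    MeasurableSet.univ_pi' (fun i => measurableSet_Ioc)
  have h2 := measurePreserving_subtype_coe (μa := (volume : Measure (Fin d → ℝ))) hm
  have h3 := (PiLp.volume_preserving_toLp (Fin d)).restrict_preimage
    (measurableSet_unitCube (d := d))
  have h4 : (@WithLp.toLp 2 (Fin d → ℝ) ⁻¹' unitCube d) =
      {x : Fin d → ℝ | ∀ i, x i ∈ Set.Ioc (0 : ℝ) (0 + 1)} := by
    ext; simp [unitCube]
  rw [h4] at h3
  exact h3.comp (h2.comp h1)

theorem phase_torusRep (γ : Fin d → ℤ) (t : UnitAddTorus (Fin d)) :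
    Complex.exp (-(2 * Real.pi * (inner ℝ (realVec γ) (torusRep t) : ℝ) * Complex.I)) =
      UnitAddTorus.mFourier (-γ) t := by
  have ht : ∀ i, t i = ((torusRep t i : ℝ) : UnitAddCircle) := fun i =>
    ((AddCircle.equivIoc 1 (0 : ℝ)).symm_apply_apply (t i)).symm
  have : UnitAddTorus.mFourier (-γ) t = ∏ i, fourier (-γ i) (t i) := rfl
  rw [this, inner_realVec]
  simp_rw [fun i => congrArg (fourier (-γ i)) (ht i), fourier_coe_apply]
  rw [← Complex.exp_sum]
  congr 1
  push_cast
  rw [Finset.mul_sum, Finset.sum_mul, ← Finset.sum_neg_distrib]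
  exact Finset.sum_congr rfl fun i _ => by simp; ring

theorem fcoef_indicator_unitCube {p : EuclideanSpace ℝ (Fin d) → ℂ} (hp : MemLp p 2)
    (γ : Fin d → ℤ) :
    fcoef ((unitCube d).indicator p) γ = UnitAddTorus.mFourierCoeff (p ∘ torusRep) γ := by
  have h1 : fcoef ((unitCube d).indicator p) γ = ∫ y in unitCube d,
      Complex.exp (-(2 * Real.pi * (inner ℝ (realVec γ) y : ℝ) * Complex.I)) * p y := by
    rw [← integral_indicator measurableSet_unitCube]
    refine integral_congr_ae (Filter.Eventually.of_forall fun y => ?_)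
    by_cases hy : y ∈ unitCube d <;> simp [hy]
  rw [h1, ← measurePreserving_torusRep.map_eq, integral_map
    measurePreserving_torusRep.measurable.aemeasurable]
  · simp_rw [phase_torusRep]; rfl
  · rw [measurePreserving_torusRep.map_eq]
    exact (continuous_phase γ).aestronglyMeasurable.mul hp.1.restrict

/-- Parseval's identity on the unit cube. -/
theorem parseval_unitCube {p q : EuclideanSpace ℝ (Fin d) → ℂ} (hp : MemLp p 2) (hq : MemLp q 2) :
    HasSum (fun γ => fcoef ((unitCube d).indicator p) γ * conj (fcoef ((unitCube d).indicator q) γ))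
      (∫ y in unitCube d, p y * conj (q y)) := by
  have hE := measurePreserving_torusRep (d := d)
  have hp' : MemLp (p ∘ torusRep) 2 := (hp.restrict _).comp_measurePreserving hE
  have hq' : MemLp (q ∘ torusRep) 2 := (hq.restrict _).comp_measurePreserving hE
  have key := UnitAddTorus.hasSum_prod_mFourierCoeff (hq'.toLp _) (hp'.toLp _)
  have e1 : ∫ t, conj (hq'.toLp _ t) * hp'.toLp _ t = ∫ y in unitCube d, p y * conj (q y) := by
    rw [← hE.map_eq, integral_map hE.measurable.aemeasurable]
    · refine integral_congr_ae ?_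
      filter_upwards [hp'.coeFn_toLp, hq'.coeFn_toLp] with t h1 h2
      rw [h1, h2, mul_comm]; rfl
    · rw [hE.map_eq]
      exact hp.1.restrict.mul (Complex.continuous_conj.comp_aestronglyMeasurable hq.1.restrict)
  have e2 : ∀ {r : EuclideanSpace ℝ (Fin d) → ℂ} (hr : MemLp r 2)
      (hr' : MemLp (r ∘ torusRep) 2) (γ : Fin d → ℤ),
      UnitAddTorus.mFourierCoeff (hr'.toLp _) γ = fcoef ((unitCube d).indicator r) γ := by
    intro r hr hr' γ
    rw [fcoef_indicator_unitCube hr]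
    refine integral_congr_ae ?_
    filter_upwards [hr'.coeFn_toLp] with t h1
    rw [h1]
  rw [e1] at key
  refine key.congr_fun fun γ => ?_
  rw [e2 hp, e2 hq, mul_comm]

end Parseval

/-! ### Parseval's identity for periodisations -/

section Periodisation

variable {d : ℕ}

theorem realVec_add (a b : Fin d → ℤ) : realVec (a + b) = realVec a + realVec b := by
  ext; simp [realVec]

theorem realVec_neg (a : Fin d → ℤ) : realVec (-a) = -realVec a := by
  ext; simp [realVec]

theorem realVec_zero : realVec (0 : Fin d → ℤ) = 0 := by
  ext; simp [realVec]

@[simp] theorem realVec_apply (a : Fin d → ℤ) (i : Fin d) : realVec a i = a i := rfl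

/-- The integer vector `a` with `y ∈ a + (0, 1]ᵈ`. -/
noncomputable def cubeIndex (y : EuclideanSpace ℝ (Fin d)) : Fin d → ℤ := fun i => ⌈y i⌉ - 1

theorem sub_realVec_mem_unitCube {y : EuclideanSpace ℝ (Fin d)} {a : Fin d → ℤ} :
    y - realVec a ∈ unitCube d ↔ cubeIndex y = a := by
  simp only [unitCube, Set.mem_Ioc, Set.mem_ofPred_eq, PiLp.sub_apply, realVec_apply, funext_iff,
    cubeIndex, sub_eq_iff_eq_add, Int.ceil_eq_iff]
  refine forall_congr' fun i => ?_
  push_cast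
  constructor <;> rintro ⟨h1, h2⟩ <;> constructor <;> linarith

theorem cubeIndex_add_realVec {y : EuclideanSpace ℝ (Fin d)} (hy : y ∈ unitCube d)
    (a : Fin d → ℤ) : cubeIndex (y + realVec a) = a := by
  rw [← sub_realVec_mem_unitCube]; simpa using hy

/-- `p` vanishes outside some ball. -/
def HasBddSupport (p : EuclideanSpace ℝ (Fin d) → ℂ) : Prop := ∃ R : ℝ, ∀ y, p y ≠ 0 → ‖y‖ ≤ R

theorem HasBddSupport.exists_finset {p : EuclideanSpace ℝ (Fin d) → ℂ} (hp : HasBddSupport p) :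
    ∃ A : Finset (Fin d → ℤ), ∀ y, p y ≠ 0 → cubeIndex y ∈ A := by
  obtain ⟨R, hR⟩ := hp
  refine ⟨Fintype.piFinset fun _ => Finset.Icc (⌈-R⌉ - 1) (⌈R⌉ - 1), fun y hy => ?_⟩
  rw [Fintype.mem_piFinset]
  intro i
  have h1 : |y i| ≤ R := by
    rw [← Real.norm_eq_abs]; exact (PiLp.norm_apply_le y i).trans (hR y hy)
  rw [abs_le] at h1
  exact Finset.mem_Icc.2 ⟨sub_le_sub_right (Int.ceil_mono h1.1) 1,
    sub_le_sub_right (Int.ceil_mono h1.2) 1⟩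

theorem integral_eq_sum_unitCube {F : EuclideanSpace ℝ (Fin d) → ℂ} (hF : Integrable F)
    {A : Finset (Fin d → ℤ)} (hA : ∀ y, F y ≠ 0 → cubeIndex y ∈ A) :
    ∫ y, F y = ∑ a ∈ A, ∫ y in unitCube d, F (y + realVec a) := by
  classical
  have hm : ∀ a : Fin d → ℤ, MeasurableSet ((fun y => y - realVec a) ⁻¹' unitCube d) :=
    fun a => (measurable_id.sub_const _) measurableSet_unitCube
  have h1 : ∀ y, F y = ∑ a ∈ A, ((fun y => y - realVec a) ⁻¹' unitCube d).indicator F y := by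
    intro y
    simp only [Set.indicator_apply, Set.mem_preimage, sub_realVec_mem_unitCube]
    rw [Finset.sum_ite_eq]
    split_ifs with h
    · rfl
    · by_contra h0; exact h (hA y h0)
  simp_rw [fun y => h1 y]
  rw [integral_finsetSum _ fun a _ => hF.indicator (hm a)]
  refine Finset.sum_congr rfl fun a ha => ?_
  rw [← integral_add_right_eq_self _ (realVec a), ← integral_indicator measurableSet_unitCube]
  congr 1 with y
  by_cases hy : y ∈ unitCube d
  · rw [Set.indicator_of_mem (by simpa using hy), Set.indicator_of_mem hy, ← h1]
  · rw [Set.indicator_of_notMem (by simpa using hy), Set.indicator_of_notMem hy]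

theorem phase_add_realVec (γ a : Fin d → ℤ) (y : EuclideanSpace ℝ (Fin d)) :
    Complex.exp (-(2 * Real.pi * (inner ℝ (realVec γ) (y + realVec a) : ℝ) * Complex.I)) =
      Complex.exp (-(2 * Real.pi * (inner ℝ (realVec γ) y : ℝ) * Complex.I)) := by
  rw [inner_add_right, Complex.exp_eq_exp_iff_exists_int]
  refine ⟨-∑ i, γ i * a i, ?_⟩
  rw [inner_realVec γ (realVec a)]
  push_cast
  simp only [realVec_apply]
  push_cast
  ring

theorem HasBddSupport.integrable {p : EuclideanSpace ℝ (Fin d) → ℂ} (hp : HasBddSupport p)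
    (h2 : MemLp p 2) : Integrable p := by
  obtain ⟨R, hR⟩ := hp
  have h3 : MemLp ((Metric.closedBall (0 : EuclideanSpace ℝ (Fin d)) R).indicator
      (fun _ => (1 : ℂ))) 2 volume :=
    memLp_indicator_const 2 measurableSet_closedBall 1
      (Or.inr (measure_closedBall_lt_top).ne)
  have h4 := h2.integrable_mul h3
  refine h4.congr (Filter.Eventually.of_forall fun y => ?_)
  by_cases h : p y = 0
  · simp [h]
  · simp [hR y h]

theorem fcoef_eq_sum {p : EuclideanSpace ℝ (Fin d) → ℂ} (hp : MemLp p 2) (hb : HasBddSupport p)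
    {A : Finset (Fin d → ℤ)} (hA : ∀ y, p y ≠ 0 → cubeIndex y ∈ A) (γ : Fin d → ℤ) :
    fcoef p γ = ∑ a ∈ A, fcoef ((unitCube d).indicator fun y => p (y + realVec a)) γ := by
  rw [fcoef, integral_eq_sum_unitCube (A := A)]
  · refine Finset.sum_congr rfl fun a _ => ?_
    rw [fcoef, ← integral_indicator measurableSet_unitCube]
    congr 1 with y
    by_cases hy : y ∈ unitCube d
    · simp only [Set.indicator_of_mem hy, phase_add_realVec]
    · simp only [Set.indicator_of_notMem hy, mul_zero]
  · exact (hb.integrable hp).bdd_mul (c := 1) (continuous_phase γ).aestronglyMeasurable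
      (Filter.Eventually.of_forall fun _ => (norm_phase γ _).le)
  · exact fun _ hy => hA _ (right_ne_zero_of_mul hy)

theorem memLp_comp_add_right {p : EuclideanSpace ℝ (Fin d) → ℂ} (hp : MemLp p 2)
    (a : EuclideanSpace ℝ (Fin d)) : MemLp (fun y => p (y + a)) 2 :=
  hp.comp_measurePreserving (measurePreserving_add_right volume a)

theorem memLp_conj {p : EuclideanSpace ℝ (Fin d) → ℂ} (hp : MemLp p 2) :
    MemLp (fun y => conj (p y)) 2 :=
  hp.congr_norm (Complex.continuous_conj.comp_aestronglyMeasurable hp.1)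
    (Filter.Eventually.of_forall fun _ => (RCLike.norm_conj _).symm)

/-- Parseval's identity for the `ℤᵈ`-periodisations of two functions of bounded support. -/
theorem hasSum_fcoef_mul_conj {p q : EuclideanSpace ℝ (Fin d) → ℂ} (hp : MemLp p 2)
    (hq : MemLp q 2) (hpb : HasBddSupport p) (hqb : HasBddSupport q) :
    HasSum (fun γ => fcoef p γ * conj (fcoef q γ))
      (∑' n : Fin d → ℤ, ∫ y, p y * conj (q (y + realVec n))) := by
  classical
  obtain ⟨A₁, hA₁⟩ := hpb.exists_finset
  obtain ⟨A₂, hA₂⟩ := hqb.exists_finset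
  set K : (Fin d → ℤ) → (Fin d → ℤ) → ℂ := fun a b =>
    ∫ y in unitCube d, p (y + realVec a) * conj (q (y + realVec b)) with hK
  have hK0 : ∀ a b, b ∉ A₂ → K a b = 0 := by
    intro a b hb
    refine setIntegral_eq_zero_of_forall_eq_zero fun y hy => ?_
    have : q (y + realVec b) = 0 := by
      by_contra h
      exact hb (by simpa [cubeIndex_add_realVec hy] using hA₂ _ h)
    simp [this]
  have h1 : ∀ n : Fin d → ℤ, ∫ y, p y * conj (q (y + realVec n)) = ∑ a ∈ A₁, K a (a + n) := by
    intro n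
    rw [integral_eq_sum_unitCube (A := A₁)]
    · simp only [hK, realVec_add, add_assoc]
    · exact hp.integrable_mul (memLp_conj (memLp_comp_add_right hq (realVec n)))
    · exact fun _ hy => hA₁ _ (left_ne_zero_of_mul hy)
  have h2 : HasSum (fun n : Fin d → ℤ => ∑ a ∈ A₁, K a (a + n)) (∑ a ∈ A₁, ∑ b ∈ A₂, K a b) := by
    refine hasSum_sum fun a _ => ?_
    exact (Equiv.addLeft a).hasSum_iff.2 (hasSum_sum_of_ne_finset_zero fun b hb => hK0 a b hb)
  simp_rw [h1]
  rw [h2.tsum_eq]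
  have h3 : HasSum (fun γ => ∑ a ∈ A₁, ∑ b ∈ A₂,
      fcoef ((unitCube d).indicator fun y => p (y + realVec a)) γ *
      conj (fcoef ((unitCube d).indicator fun y => q (y + realVec b)) γ))
      (∑ a ∈ A₁, ∑ b ∈ A₂, K a b) :=
    hasSum_sum fun a _ => hasSum_sum fun b _ => parseval_unitCube
      (memLp_comp_add_right hp (realVec a)) (memLp_comp_add_right hq (realVec b))
  refine h3.congr_fun fun γ => ?_
  rw [fcoef_eq_sum hp hpb hA₁, fcoef_eq_sum hq hqb hA₂, map_sum, Finset.sum_mul_sum]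

end Periodisation

/-! ### Translations and modulations -/

section TimeFrequency

variable {d : ℕ}

theorem coeFn_translateL2 (a : EuclideanSpace ℝ (Fin d)) (f : L2 d) :
    translateL2 a f =ᵐ[volume] fun x => f (x - a) :=
  Lp.coeFn_compMeasurePreserving _ _

theorem coeFn_modulateL2 (b : EuclideanSpace ℝ (Fin d)) (f : L2 d) :
    modulateL2 b f =ᵐ[volume]
      fun x => Complex.exp (2 * Real.pi * (inner ℝ b x : ℝ) * Complex.I) * f x :=
  MemLp.coeFn_toLp _

/-- Translation as a continuous linear map. -/
noncomputable def translateCLM (a : EuclideanSpace ℝ (Fin d)) : L2 d →L[ℂ] L2 d :=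
  (Lp.compMeasurePreservingₗᵢ ℂ (fun x => x - a)
    (measurePreserving_sub_right volume a)).toContinuousLinearMap

theorem translateCLM_apply (a : EuclideanSpace ℝ (Fin d)) (f : L2 d) :
    translateCLM a f = translateL2 a f := rfl

theorem norm_modulateL2 (b : EuclideanSpace ℝ (Fin d)) (f : L2 d) :
    ‖modulateL2 b f‖ = ‖f‖ := by
  rw [Lp.norm_def, Lp.norm_def]
  congr 1
  refine eLpNorm_congr_norm_ae ?_
  filter_upwards [coeFn_modulateL2 b f] with x hx
  have h := Complex.norm_exp_ofReal_mul_I (2 * Real.pi * (inner ℝ b x : ℝ))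
  push_cast at h
  rw [hx, norm_mul, h, one_mul]

/-- Modulation as a linear isometry. -/
noncomputable def modulateₗᵢ (b : EuclideanSpace ℝ (Fin d)) : L2 d →ₗᵢ[ℂ] L2 d where
  toFun := modulateL2 b
  map_add' f g := by
    refine Lp.ext ?_
    filter_upwards [coeFn_modulateL2 b (f + g), coeFn_modulateL2 b f, coeFn_modulateL2 b g,
      Lp.coeFn_add f g, Lp.coeFn_add (modulateL2 b f) (modulateL2 b g)] with x h1 h2 h3 h4 h5
    rw [h1, h5, Pi.add_apply, h4, h2, h3, Pi.add_apply, mul_add]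
  map_smul' c f := by
    refine Lp.ext ?_
    filter_upwards [coeFn_modulateL2 b (c • f), coeFn_modulateL2 b f,
      Lp.coeFn_smul c f, Lp.coeFn_smul c (modulateL2 b f)] with x h1 h2 h3 h4
    rw [h1, RingHom.id_apply, h4, Pi.smul_apply, h2, h3, Pi.smul_apply, smul_eq_mul, smul_eq_mul]
    ring
  norm_map' := norm_modulateL2 b

/-- Modulation as a continuous linear map. -/
noncomputable def modulateCLM (b : EuclideanSpace ℝ (Fin d)) : L2 d →L[ℂ] L2 d :=
  (modulateₗᵢ b).toContinuousLinearMap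

theorem inner_translateL2 (a : EuclideanSpace ℝ (Fin d)) (f g : L2 d) :
    inner ℂ (translateL2 a f) (translateL2 a g) = inner ℂ f g :=
  LinearIsometry.inner_map_map (Lp.compMeasurePreservingₗᵢ ℂ (fun x => x - a)
    (measurePreserving_sub_right volume a)) f g

theorem inner_modulateL2 (b : EuclideanSpace ℝ (Fin d)) (f g : L2 d) :
    inner ℂ (modulateL2 b f) (modulateL2 b g) = inner ℂ f g :=
  (modulateₗᵢ b).inner_map_map f g

theorem ae_comp_sub {p : EuclideanSpace ℝ (Fin d) → Prop} (h : ∀ᵐ x, p x)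
    (a : EuclideanSpace ℝ (Fin d)) : ∀ᵐ x, p (x - a) :=
  (measurePreserving_sub_right volume a).quasiMeasurePreserving.ae h

theorem translateL2_translateL2 (a b : EuclideanSpace ℝ (Fin d)) (f : L2 d) :
    translateL2 a (translateL2 b f) = translateL2 (a + b) f := by
  refine Lp.ext ?_
  filter_upwards [coeFn_translateL2 a (translateL2 b f), coeFn_translateL2 (a + b) f,
    ae_comp_sub (coeFn_translateL2 b f) a] with x h1 h2 h3
  rw [h1, h2, h3, sub_sub]

theorem modulateL2_modulateL2 (a b : EuclideanSpace ℝ (Fin d)) (f : L2 d) :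
    modulateL2 a (modulateL2 b f) = modulateL2 (a + b) f := by
  refine Lp.ext ?_
  filter_upwards [coeFn_modulateL2 a (modulateL2 b f), coeFn_modulateL2 (a + b) f,
    coeFn_modulateL2 b f] with x h1 h2 h3
  rw [h1, h2, h3, ← mul_assoc, ← Complex.exp_add, inner_add_left]
  push_cast
  ring_nf

theorem modulateL2_zero (f : L2 d) : modulateL2 0 f = f := by
  refine Lp.ext ?_
  filter_upwards [coeFn_modulateL2 0 f] with x h1
  simp [h1]

theorem modulateL2_translateL2 (a b : EuclideanSpace ℝ (Fin d)) (f : L2 d) :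
    modulateL2 b (translateL2 a f) =
      Complex.exp (2 * Real.pi * (inner ℝ b a : ℝ) * Complex.I) •
        translateL2 a (modulateL2 b f) := by
  refine Lp.ext ?_
  filter_upwards [coeFn_modulateL2 b (translateL2 a f), coeFn_translateL2 a f,
    coeFn_translateL2 a (modulateL2 b f), ae_comp_sub (coeFn_modulateL2 b f) a,
    Lp.coeFn_smul (Complex.exp (2 * Real.pi * (inner ℝ b a : ℝ) * Complex.I))
      (translateL2 a (modulateL2 b f))] with x h1 h2 h3 h4 h5
  rw [h1, h2, h5, Pi.smul_apply, h3, h4, smul_eq_mul, ← mul_assoc, ← Complex.exp_add,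
    inner_sub_right]
  push_cast
  ring_nf

theorem fcoef_congr {p q : EuclideanSpace ℝ (Fin d) → ℂ} (h : p =ᵐ[volume] q) (γ : Fin d → ℤ) :
    fcoef p γ = fcoef q γ := by
  refine integral_congr_ae ?_
  filter_upwards [h] with y hy
  rw [hy]

/-- The coefficient of `f` with respect to a time-frequency shift is a Fourier coefficient of a
pointwise product. -/
theorem inner_translate_modulate (a : EuclideanSpace ℝ (Fin d)) (γ : Fin d → ℤ) (u : L2 d)
    {f : EuclideanSpace ℝ (Fin d) → ℂ} (hf : MemLp f 2) :
    inner ℂ (translateL2 a (modulateL2 (realVec γ) u)) (hf.toLp f) =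
      fcoef (fun y => conj (u y) * f (y + a)) γ := by
  rw [L2.inner_def, fcoef, ← integral_sub_right_eq_self (fun y =>
    Complex.exp (-(2 * Real.pi * (inner ℝ (realVec γ) y : ℝ) * Complex.I)) *
      (conj (u y) * f (y + a))) a]
  refine integral_congr_ae ?_
  filter_upwards [coeFn_translateL2 a (modulateL2 (realVec γ) u),
    ae_comp_sub (coeFn_modulateL2 (realVec γ) u) a, hf.coeFn_toLp] with x h1 h2 h3
  rw [RCLike.inner_apply, h1, h2, h3, map_mul, ← Complex.exp_conj]
  simp only [map_mul, Complex.conj_I, Complex.conj_ofReal, sub_add_cancel, map_ofNat]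
  ring_nf

/-- A frame operator commutes with every isometry that permutes the system up to unimodular
factors. -/
theorem IsFrameOperator.comm_of_permutes {ι H : Type*} [NormedAddCommGroup H]
    [InnerProductSpace ℂ H] {φ : ι → H} {S : H →L[ℂ] H} (hS : IsFrameOperator φ S)
    (U : H →L[ℂ] H) (hU : ∀ x y, inner ℂ (U x) (U y) = inner ℂ x y) (e : ι ≃ ι) (c : ι → ℂ)
    (hc : ∀ i, ‖c i‖ = 1) (hUφ : ∀ i, U (φ i) = c i • φ (e i)) (f : H) : S (U f) = U (S f) := by
  have h1 := (e.hasSum_iff.2 (hS (U f)))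
  have h2 := (hS f).mapL U
  refine h1.unique (h2.congr_fun fun i => ?_)
  have hcc : conj (c i) * c i = 1 := by
    rw [Complex.conj_mul', hc]; simp
  have hφ : φ (e i) = conj (c i) • U (φ i) := by
    rw [hUφ, smul_smul, hcc, one_smul]
  simp only [Function.comp_apply]
  rw [hφ, inner_smul_left, hU, map_smul, smul_smul, Complex.conj_conj]
  congr 1
  linear_combination (inner ℂ (φ i) f) * hcc

end TimeFrequency

/-! ### Separable groups, signs and orbits -/

section Combinatorics

variable {d k : ℕ}

theorem neg_one_zpow_congr {a b : ℤ} (h : ((a : ℤ) : ZMod 2) = b) : (-1 : ℂ) ^ a = (-1) ^ b := by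
  have h1 : Even (a - b) := by
    rw [← ZMod.intCast_eq_zero_iff_even]; push_cast; rw [h, sub_self]
  have h2 : a = (a - b) + b := by ring
  rw [h2, zpow_add₀ (by norm_num), h1.neg_one_zpow, one_mul]

theorem intCast_lift01 (σ : Fin d → ZMod 2) (j : Fin d) : ((lift01 σ j : ℤ) : ZMod 2) = σ j := by
  simp [lift01]

theorem lift01_mem_lattice {G : AddSubgroup (Fin d → ZMod 2)} {σ : Fin d → ZMod 2} (h : σ ∈ G) :
    lift01 σ ∈ lattice G := by
  change (fun n => ((lift01 σ n : ℤ) : ZMod 2)) ∈ G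
  simpa only [intCast_lift01] using h

/-- The sign `(-1)^⟨α, σ⟩`. -/
noncomputable def pairSign (α : Fin d → ℤ) (σ : Fin d → ZMod 2) : ℂ :=
  (-1) ^ (∑ j, α j * lift01 σ j)

theorem pairSign_congr {α β : Fin d → ℤ} {σ τ : Fin d → ZMod 2}
    (h : ∑ j, (α j : ZMod 2) * σ j = ∑ j, (β j : ZMod 2) * τ j) :
    pairSign α σ = pairSign β τ := by
  refine neg_one_zpow_congr ?_
  push_cast
  simpa only [intCast_lift01] using h

theorem pairSign_add_left (α β : Fin d → ℤ) (σ : Fin d → ZMod 2) :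
    pairSign (α + β) σ = pairSign α σ * pairSign β σ := by
  rw [pairSign, pairSign, pairSign, ← zpow_add₀ (by norm_num), ← Finset.sum_add_distrib]
  simp only [Pi.add_apply, add_mul]

theorem pairSign_add_right (α : Fin d → ℤ) (σ τ : Fin d → ZMod 2) :
    pairSign α (σ + τ) = pairSign α σ * pairSign α τ := by
  rw [pairSign, pairSign, pairSign, ← zpow_add₀ (by norm_num), ← Finset.sum_add_distrib]
  refine neg_one_zpow_congr ?_
  push_cast
  simp only [intCast_lift01, Pi.add_apply, mul_add]

@[simp] theorem pairSign_zero_right (α : Fin d → ℤ) : pairSign α 0 = 1 := by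
  simp [pairSign, lift01]

theorem pairSign_sum_right {ι : Type*} (α : Fin d → ℤ) (T : Finset ι) (s : ι → Fin d → ZMod 2) :
    pairSign α (∑ j ∈ T, s j) = ∏ j ∈ T, pairSign α (s j) := by
  classical
  induction T using Finset.induction_on with
  | empty => simp
  | insert a T ha ih => rw [Finset.sum_insert ha, Finset.prod_insert ha, pairSign_add_right, ih]

theorem pairSign_eq_or (α : Fin d → ℤ) (σ : Fin d → ZMod 2) :
    pairSign α σ = 1 ∨ pairSign α σ = -1 := by
  rcases Int.even_or_odd (∑ j, α j * lift01 σ j) with h | h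
  · exact Or.inl h.neg_one_zpow
  · exact Or.inr h.neg_one_zpow

@[simp] theorem norm_pairSign (α : Fin d → ℤ) (σ : Fin d → ZMod 2) : ‖pairSign α σ‖ = 1 := by
  rcases pairSign_eq_or α σ with h | h <;> rw [h] <;> norm_num

@[simp] theorem conj_pairSign (α : Fin d → ℤ) (σ : Fin d → ZMod 2) :
    conj (pairSign α σ) = pairSign α σ := by
  rcases pairSign_eq_or α σ with h | h <;> rw [h] <;> simp

theorem zmod_two_cases (a : ZMod 2) : a = 0 ∨ a = 1 := by
  revert a; decide

theorem zmod_two_add_self (σ : Fin d → ZMod 2) : σ + σ = 0 := by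
  ext j
  have : ∀ a : ZMod 2, a + a = 0 := by decide
  exact this _

theorem sign_add {R : Type*} [Ring R] (a b : ZMod 2) :
    (-1 : R) ^ (a + b).val = (-1) ^ a.val * (-1) ^ b.val := by
  rcases zmod_two_cases a with rfl | rfl <;> rcases zmod_two_cases b with rfl | rfl <;>
    simp [show (1 + 1 : ZMod 2) = 0 from rfl, show (1 : ZMod 2).val = 1 from rfl]

theorem reflect_add (σ τ : Fin d → ZMod 2) (x : Fin d → ℤ) :
    reflect (σ + τ) x = reflect σ (reflect τ x) := by
  ext j; simp only [reflect, Pi.add_apply, sign_add, mul_assoc]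

@[simp] theorem reflect_zero (x : Fin d → ℤ) : reflect 0 x = x := by
  ext j; simp [reflect]

@[simp] theorem reflect_reflect (σ : Fin d → ZMod 2) (x : Fin d → ℤ) :
    reflect σ (reflect σ x) = x := by
  rw [← reflect_add, zmod_two_add_self, reflect_zero]

theorem intCast_reflect (σ : Fin d → ZMod 2) (x : Fin d → ℤ) (j : Fin d) :
    ((reflect σ x j : ℤ) : ZMod 2) = x j := by
  rcases zmod_two_cases (σ j) with h | h <;> simp [reflect, h]

/-- The reflection `R_σ` as a permutation of `ℤᵈ`. -/
def reflectEquiv (σ : Fin d → ZMod 2) : (Fin d → ℤ) ≃ (Fin d → ℤ) :=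
  ⟨reflect σ, reflect σ, reflect_reflect σ, reflect_reflect σ⟩

theorem pairSign_reflect_left (α : Fin d → ℤ) (σ τ : Fin d → ZMod 2) :
    pairSign (reflect τ α) σ = pairSign α σ :=
  pairSign_congr (by simp only [intCast_reflect])

/-- Elements of a separable group are sums of distinct generators. -/
theorem IsSeparableGroup.mem_iff {G : AddSubgroup (Fin d → ZMod 2)} {s : Fin k → Fin d → ZMod 2}
    (hG : IsSeparableGroup G s) (σ : Fin d → ZMod 2) :
    σ ∈ G ↔ ∃ T : Finset (Fin k), σ = ∑ i ∈ T, s i := by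
  classical
  have hs : ∀ i, s i ∈ G := fun i => by
    rw [← hG.closure_eq]; exact AddSubgroup.subset_closure ⟨i, rfl⟩
  constructor
  · intro h
    rw [← hG.closure_eq] at h
    induction h using AddSubgroup.closure_induction with
    | mem x hx =>
      obtain ⟨i, rfl⟩ := hx
      exact ⟨{i}, by simp⟩
    | zero => exact ⟨∅, by simp⟩
    | add x y _ _ hx hy =>
      obtain ⟨T, rfl⟩ := hx
      obtain ⟨U, rfl⟩ := hy
      refine ⟨symmDiff T U, ?_⟩
      have h1 : symmDiff T U = (T \ U) ∪ (U \ T) := rfl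
      rw [h1, Finset.sum_union (Finset.disjoint_left.2 fun a ha hb => by
        simp at ha hb; exact hb.2 ha.1)]
      rw [← Finset.sum_inter_add_sum_sdiff T U, ← Finset.sum_inter_add_sum_sdiff U T,
        Finset.inter_comm U T]
      have := zmod_two_add_self (∑ i ∈ T ∩ U, s i)
      symm
      calc _ = (∑ i ∈ T ∩ U, s i + ∑ i ∈ T ∩ U, s i) + (∑ i ∈ T \ U, s i + ∑ i ∈ U \ T, s i) := by
            rw [this, zero_add]
        _ = _ := by abel
    | neg x _ hx =>
      obtain ⟨T, rfl⟩ := hx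
      exact ⟨T, neg_eq_of_add_eq_zero_left (zmod_two_add_self _)⟩
  · rintro ⟨T, rfl⟩
    exact sum_mem fun i _ => hs i

theorem IsSeparableGroup.eq_of_ne_zero {G : AddSubgroup (Fin d → ZMod 2)}
    {s : Fin k → Fin d → ZMod 2} (hG : IsSeparableGroup G s) {i i' : Fin k} {j : Fin d}
    (h : s i j ≠ 0) (h' : s i' j ≠ 0) : i = i' := by
  by_contra hab
  exact Set.disjoint_left.1 (hG.disjoint_support i i' hab) h h'

theorem IsSeparableGroup.sum_apply {G : AddSubgroup (Fin d → ZMod 2)}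
    {s : Fin k → Fin d → ZMod 2} (hG : IsSeparableGroup G s) (T : Finset (Fin k)) {i : Fin k}
    {j : Fin d} (h : s i j ≠ 0) : (∑ m ∈ T, s m) j = if i ∈ T then s i j else 0 := by
  classical
  rw [Finset.sum_apply, ← Finset.sum_ite_eq T i fun m => s m j]
  refine Finset.sum_congr rfl fun m _ => ?_
  split_ifs with hm
  · rfl
  · by_contra h'
    exact hm (hG.eq_of_ne_zero h h')

theorem IsSeparableGroup.card_eq {G : AddSubgroup (Fin d → ZMod 2)}
    {s : Fin k → Fin d → ZMod 2} (hG : IsSeparableGroup G s) : Nat.card G = 2 ^ k := by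
  classical
  let e : Finset (Fin k) → G := fun T => ⟨∑ i ∈ T, s i, (hG.mem_iff _).2 ⟨T, rfl⟩⟩
  have he : Function.Bijective e := by
    constructor
    · intro T U h
      have h1 : ∑ i ∈ T, s i = ∑ i ∈ U, s i := congrArg Subtype.val h
      ext i
      obtain ⟨j, hj⟩ := Function.ne_iff.1 (hG.ne_zero i)
      have h2 := congrFun h1 j
      rw [hG.sum_apply T hj, hG.sum_apply U hj] at h2
      by_cases hT : i ∈ T <;> by_cases hU : i ∈ U <;> simp [hT, hU] at h2 ⊢
      · exact hj h2
      · exact hj h2.symm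
    · rintro ⟨σ, hσ⟩
      obtain ⟨T, rfl⟩ := (hG.mem_iff σ).1 hσ
      exact ⟨T, rfl⟩
  rw [← Nat.card_eq_of_bijective e he]
  simp

/-- Every non-zero `σ ∈ G` contains a generator `s i`, and `⟨I(s i), σ⟩` is odd. -/
theorem IsSeparableGroup.exists_generator {G : AddSubgroup (Fin d → ZMod 2)}
    {s : Fin k → Fin d → ZMod 2} (hG : IsSeparableGroup G s)
    {rep : DualGroup G → Fin d → ℤ} (hrep : ∀ q, QuotientAddGroup.mk (rep q) = q)
    {σ : Fin d → ZMod 2} (hσ : σ ∈ G) (h0 : σ ≠ 0) :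
    ∃ (i : Fin k) (hi : s i ∈ G), (∀ j, s i j ≠ 0 → σ j = 1) ∧
      ∀ h : G, pairSign (rep (dualHom G s (h + ⟨s i, hi⟩))) σ =
        -pairSign (rep (dualHom G s h)) σ := by
  classical
  obtain ⟨T, rfl⟩ := (hG.mem_iff σ).1 hσ
  obtain ⟨i, hiT⟩ : T.Nonempty := by
    rw [Finset.nonempty_iff_ne_empty]
    rintro rfl
    exact h0 (by simp)
  have hi : s i ∈ G := (hG.mem_iff _).2 ⟨{i}, by simp⟩
  refine ⟨i, hi, fun j hj => ?_, fun h => ?_⟩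
  · rw [hG.sum_apply T hj, if_pos hiT]
    exact (zmod_two_cases _).resolve_left hj
  · have h1 : pairSign (rep (dualHom G s ⟨s i, hi⟩)) (∑ m ∈ T, s m) = -1 := by
      rw [pairSign_sum_right, ← Finset.mul_prod_erase T _ hiT, Finset.prod_eq_one, mul_one]
      · have := dualHom_pairing hG i i hi _ (hrep _)
        rw [if_pos rfl] at this
        rw [pairSign, neg_one_zpow_congr (b := 1) (by simpa using this)]
        norm_num
      · intro m hm
        have := dualHom_pairing hG i m hi _ (hrep _)
        rw [if_neg (Finset.ne_of_mem_erase hm).symm] at this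
        rw [pairSign, neg_one_zpow_congr (b := 0) (by simpa using this)]
        norm_num
    have h2 : -(rep (dualHom G s h) + rep (dualHom G s ⟨s i, hi⟩)) +
        rep (dualHom G s (h + ⟨s i, hi⟩)) ∈ twoDual G := by
      rw [← QuotientAddGroup.eq, QuotientAddGroup.mk_add, hrep, hrep, hrep, map_add]
    have h3 := h2 _ (lift01_mem_lattice hσ)
    have h4 := pairSign_add_left (rep (dualHom G s h) + rep (dualHom G s ⟨s i, hi⟩))
      (-(rep (dualHom G s h) + rep (dualHom G s ⟨s i, hi⟩)) +
        rep (dualHom G s (h + ⟨s i, hi⟩))) (∑ m ∈ T, s m)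
    have h5 : pairSign (-(rep (dualHom G s h) + rep (dualHom G s ⟨s i, hi⟩)) +
        rep (dualHom G s (h + ⟨s i, hi⟩))) (∑ m ∈ T, s m) = 1 := h3.neg_one_zpow
    rw [h5, mul_one, add_neg_cancel_left, pairSign_add_left, h1, mul_neg_one] at h4
    exact h4

/-- The class modulo `2` of a point of `Λ`. -/
def latticeClass {G : AddSubgroup (Fin d → ZMod 2)} (μ : lattice G) : G :=
  ⟨fun j => ((μ : Fin d → ℤ) j : ZMod 2), μ.2⟩

theorem two_mul_add_lift01_mem {G : AddSubgroup (Fin d → ZMod 2)} (l : Fin d → ℤ) (h : G) :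
    (fun j => 2 * l j + lift01 (h : Fin d → ZMod 2) j) ∈ lattice G := by
  change (fun j => ((2 * l j + lift01 (h : Fin d → ZMod 2) j : ℤ) : ZMod 2)) ∈ G
  have : (fun j => ((2 * l j + lift01 (h : Fin d → ZMod 2) j : ℤ) : ZMod 2)) = h := by
    ext j
    push_cast
    rw [intCast_lift01, show (2 : ZMod 2) = 0 from rfl, zero_mul, zero_add]
  rw [this]
  exact h.2

/-- `Λ` is the disjoint union of the cosets `h + 2ℤᵈ`, `h ∈ G`. -/
def latticeEquiv (G : AddSubgroup (Fin d → ZMod 2)) : (Fin d → ℤ) × G ≃ lattice G where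
  toFun p := ⟨fun j => 2 * p.1 j + lift01 (p.2 : Fin d → ZMod 2) j, two_mul_add_lift01_mem p.1 p.2⟩
  invFun μ := (fun j => (μ : Fin d → ℤ) j / 2, latticeClass μ)
  left_inv p := by
    obtain ⟨l, h, hh⟩ := p
    refine Prod.ext ?_ (Subtype.ext ?_)
    · ext j
      have : lift01 h j = 0 ∨ lift01 h j = 1 := by
        have h1 : lift01 h j = ((h j).val : ℤ) := rfl
        have h2 := ZMod.val_lt (h j)
        omega
      simp only
      omega
    · ext j
      simp only [latticeClass]
      push_cast
      rw [intCast_lift01, show (2 : ZMod 2) = 0 from rfl, zero_mul, zero_add]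
  right_inv μ := by
    refine Subtype.ext ?_
    ext j
    simp only [latticeClass, lift01, ZMod.val_intCast]
    push_cast
    omega

theorem latticeClass_latticeEquiv {G : AddSubgroup (Fin d → ZMod 2)} (p : (Fin d → ℤ) × G) :
    latticeClass (latticeEquiv G p) = p.2 :=
  congrArg Prod.snd ((latticeEquiv G).symm_apply_apply p)

theorem mem_orbit_symm {G : AddSubgroup (Fin d → ZMod 2)} {x y : Fin d → ℤ} (h : y ∈ orbit G x) :
    x ∈ orbit G y := by
  obtain ⟨σ, hσ, rfl⟩ := h
  exact ⟨σ, hσ, (reflect_reflect σ x).symm⟩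

/-- The map `r` sends `x` to the point of `N` in the orbit of `x`; its fibres are the orbits. -/
theorem exists_representative {G : AddSubgroup (Fin d → ZMod 2)} {N : Set (Fin d → ℤ)}
    (hN : ∀ x : Fin d → ℤ, (N ∩ orbit G x).ncard = 1) :
    ∃ r : (Fin d → ℤ) → N, ∀ x (n : N), r x = n ↔ x ∈ orbit G (n : Fin d → ℤ) := by
  have h1 : ∀ x, ∃ n, N ∩ orbit G x = {n} := fun x => Set.ncard_eq_one.1 (hN x)
  choose r hr using h1
  have h2 : ∀ x, r x ∈ N ∩ orbit G x := fun x => by rw [hr x]; rfl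
  refine ⟨fun x => ⟨r x, (h2 x).1⟩, fun x n => ?_⟩
  rw [Subtype.ext_iff]
  constructor
  · intro h
    simp only at h
    rw [← h]
    exact mem_orbit_symm (h2 x).2
  · intro h
    have : (n : Fin d → ℤ) ∈ N ∩ orbit G x := ⟨n.2, mem_orbit_symm h⟩
    rw [hr x] at this
    exact this.symm

/-- The orbit-stabiliser theorem, with the stabiliser counted through the pairs `(σ, τ)` such that
`R_σ x = R_τ x`, each of which is a pair with `σ - τ` in the stabiliser. -/
theorem ncard_orbit_mul_card_pairs (G : AddSubgroup (Fin d → ZMod 2)) (x : Fin d → ℤ)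
    [Fintype G] [DecidableEq (Fin d → ℤ)] :
    (orbit G x).ncard * (Finset.univ.filter fun p : G × G =>
      reflect (p.1 : Fin d → ZMod 2) x = reflect (p.2 : Fin d → ZMod 2) x).card =
      Fintype.card G * Fintype.card G := by
  set m := (Finset.univ.filter fun σ : G => reflect (σ : Fin d → ZMod 2) x = x).card with hm
  have hfib : ∀ τ : G, (Finset.univ.filter fun σ : G =>
      reflect (σ : Fin d → ZMod 2) x = reflect (τ : Fin d → ZMod 2) x).card = m := by
    intro τ
    refine Finset.card_bij' (fun σ _ => σ + τ) (fun σ _ => σ + τ) ?_ ?_ ?_ ?_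
    · intro σ hσ
      simp only [Finset.mem_filter, Finset.mem_univ, true_and] at hσ ⊢
      rw [AddSubgroup.coe_add, add_comm, reflect_add, hσ, reflect_reflect]
    · intro σ hσ
      simp only [Finset.mem_filter, Finset.mem_univ, true_and] at hσ ⊢
      rw [AddSubgroup.coe_add, add_comm, reflect_add, hσ]
    · intro σ _
      exact Subtype.ext (by simp [add_assoc, zmod_two_add_self])
    · intro σ _
      exact Subtype.ext (by simp [add_assoc, zmod_two_add_self])
  have hpairs : (Finset.univ.filter fun p : G × G =>
      reflect (p.1 : Fin d → ZMod 2) x = reflect (p.2 : Fin d → ZMod 2) x).card =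
      Fintype.card G * m := by
    rw [Finset.card_filter, ← Finset.univ_product_univ, Finset.sum_product_right]
    simp_rw [← Finset.card_filter, hfib]
    simp
  have horb : (orbit G x).ncard * m = Fintype.card G := by
    have h1 : orbit G x =
        ((Finset.univ.image fun σ : G => reflect (σ : Fin d → ZMod 2) x : Finset _) : Set _) := by
      ext y
      simp only [orbit, Set.mem_ofPred_eq, Finset.coe_image, Finset.coe_univ, Set.image_univ,
        Set.mem_range, Subtype.exists, exists_prop, eq_comm]
    rw [h1, Set.ncard_coe_finset, ← Finset.card_univ]
    rw [Finset.card_eq_sum_card_image (fun σ : G => reflect (σ : Fin d → ZMod 2) x) Finset.univ]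
    rw [Finset.sum_const_nat (m := m)]
    intro y hy
    obtain ⟨τ, -, rfl⟩ := Finset.mem_image.1 hy
    exact hfib τ
  rw [hpairs, mul_comm (Fintype.card G) m, ← mul_assoc, horb]

end Combinatorics

/-! ### Test functions and reflections -/

section Wiener

variable {d k : ℕ}

/-- Bounded measurable functions of bounded support. -/
structure IsTestFun (f : EuclideanSpace ℝ (Fin d) → ℂ) : Prop where
  measurable : Measurable f
  bounded : ∃ M : ℝ, ∀ x, ‖f x‖ ≤ M
  support : HasBddSupport f

theorem IsTestFun.memLp {f : EuclideanSpace ℝ (Fin d) → ℂ} (hf : IsTestFun f) : MemLp f 2 := by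
  obtain ⟨M, hM⟩ := hf.bounded
  obtain ⟨R, hR⟩ := hf.support
  have h3 : MemLp ((Metric.closedBall (0 : EuclideanSpace ℝ (Fin d)) R).indicator
      (fun _ => M)) 2 volume :=
    memLp_indicator_const 2 measurableSet_closedBall M
      (Or.inr (measure_closedBall_lt_top).ne)
  refine h3.of_le hf.measurable.aestronglyMeasurable (Filter.Eventually.of_forall fun y => ?_)
  by_cases h : f y = 0
  · simp [h]
  · rw [Set.indicator_of_mem (by simpa using hR y h)]
    exact (hM y).trans (le_abs_self M)

/-- The translates of a test function along a lattice have uniformly bounded overlap. -/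
theorem IsTestFun.tsum_translates_le {f : EuclideanSpace ℝ (Fin d) → ℂ} (hf : IsTestFun f) {c : ℝ}
    (hc : 0 < c) : ∃ C : ℝ≥0∞, C ≠ ∞ ∧ ∀ x, ∑' n : Fin d → ℤ, ‖f (x + c • realVec n)‖ₑ ≤ C := by
  classical
  obtain ⟨M, hM⟩ := hf.bounded
  obtain ⟨R, hR⟩ := hf.support
  set m : ℕ := ⌈2 * R / c⌉₊ + 1 with hm
  refine ⟨(m ^ d : ℕ) * ENNReal.ofReal M, ENNReal.mul_ne_top (by simp) (by simp), fun x => ?_⟩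
  set A : Finset (Fin d → ℤ) :=
    Fintype.piFinset fun j => Finset.Icc ⌈(-R - x j) / c⌉ ⌊(R - x j) / c⌋ with hA
  have hA0 : ∀ n ∉ A, ‖f (x + c • realVec n)‖ₑ = 0 := by
    intro n hn
    rw [enorm_eq_zero]
    by_contra h
    refine hn (Fintype.mem_piFinset.2 fun j => ?_)
    have h1 : |x j + c * n j| ≤ R := by
      have := (PiLp.norm_apply_le (x + c • realVec n) j).trans (hR _ h)
      simpa using this
    rw [abs_le] at h1
    rw [Finset.mem_Icc, Int.ceil_le, Int.le_floor, div_le_iff₀ hc, le_div_iff₀ hc]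
    constructor <;> linarith
  rw [tsum_eq_sum hA0]
  have hcard : A.card ≤ m ^ d := by
    rw [hA, Fintype.card_piFinset]
    calc _ ≤ ∏ _j : Fin d, m := Finset.prod_le_prod' fun j _ => ?_
      _ = m ^ d := by simp
    rw [Int.card_Icc]
    have h1 : (⌊(R - x j) / c⌋ : ℝ) ≤ (R - x j) / c := Int.floor_le _
    have h2 : (-R - x j) / c ≤ (⌈(-R - x j) / c⌉ : ℝ) := Int.le_ceil _
    have h3 : 2 * R / c ≤ (⌈2 * R / c⌉₊ : ℝ) := Nat.le_ceil _
    have h4 : (R - x j) / c - (-R - x j) / c = 2 * R / c := by ring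
    have h5 : ((⌊(R - x j) / c⌋ + 1 - ⌈(-R - x j) / c⌉ : ℤ) : ℝ) ≤ ((m : ℤ) : ℝ) := by
      push_cast [hm]; linarith
    have h6 : (⌊(R - x j) / c⌋ + 1 - ⌈(-R - x j) / c⌉ : ℤ) ≤ m := by exact_mod_cast h5
    omega
  calc _ ≤ ∑ _n ∈ A, ENNReal.ofReal M := Finset.sum_le_sum fun n _ => by
        rw [← ofReal_norm]; exact ENNReal.ofReal_le_ofReal (hM _)
    _ = A.card * ENNReal.ofReal M := by simp
    _ ≤ _ := by gcongr

end Wiener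

section Reflections

variable {d k : ℕ}

/-- The reflection `R_σ` on `ℝᵈ`. -/
noncomputable def reflectReal (σ : Fin d → ZMod 2) :
    EuclideanSpace ℝ (Fin d) ≃ₗᵢ[ℝ] EuclideanSpace ℝ (Fin d) :=
  LinearIsometryEquiv.piLpCongrRight 2 fun j =>
    if σ j = 0 then LinearIsometryEquiv.refl ℝ ℝ else LinearIsometryEquiv.neg ℝ

theorem reflectReal_apply (σ : Fin d → ZMod 2) (y : EuclideanSpace ℝ (Fin d)) (j : Fin d) :
    reflectReal σ y j = (-1) ^ (σ j).val * y j := by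
  rcases zmod_two_cases (σ j) with h | h
  · simp [reflectReal, h]
  · simp [reflectReal, h, show (1 : ZMod 2).val = 1 from rfl]

theorem reflectReal_realVec (σ : Fin d → ZMod 2) (n : Fin d → ℤ) :
    reflectReal σ (realVec n) = realVec (reflect σ n) := by
  ext j; rw [reflectReal_apply]; simp [reflect]

@[simp] theorem reflectReal_reflectReal (σ : Fin d → ZMod 2) (y : EuclideanSpace ℝ (Fin d)) :
    reflectReal σ (reflectReal σ y) = y := by
  ext j
  rw [reflectReal_apply, reflectReal_apply, ← mul_assoc, ← pow_add, ← two_mul]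
  simp

theorem inner_reflectReal (σ : Fin d → ZMod 2) (x y : EuclideanSpace ℝ (Fin d)) :
    inner ℝ (reflectReal σ x) y = inner ℝ x (reflectReal σ y) := by
  conv_lhs => rw [← reflectReal_reflectReal σ y]
  exact (reflectReal σ).inner_map_map x _

theorem measurePreserving_reflect_add (σ : Fin d → ZMod 2) (a t : EuclideanSpace ℝ (Fin d)) :
    MeasurePreserving (fun y => reflectReal σ (y + a) + t) :=
  (measurePreserving_add_right volume t).comp
    ((reflectReal σ).measurePreserving.comp (measurePreserving_add_right volume a))

/-- Half of an integer vector, as a point of `ℝᵈ`. -/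
noncomputable abbrev halfVec (n : Fin d → ℤ) : EuclideanSpace ℝ (Fin d) :=
  (1 / 2 : ℝ) • realVec n

theorem exp_pi_mul_int (n : ℤ) : Complex.exp (Real.pi * n * Complex.I) = (-1) ^ n := by
  rw [← Complex.exp_pi_mul_I, ← Complex.exp_int_mul]
  ring_nf

/-- Reflecting and shifting by half a reflection vector reflects the Fourier coefficients, up to
the sign `(-1)^⟨γ, σ⟩`. -/
theorem fcoef_reflect_add_half (p : EuclideanSpace ℝ (Fin d) → ℂ) (σ : Fin d → ZMod 2)
    (γ : Fin d → ℤ) :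
    fcoef (fun y => p (reflectReal σ y + halfVec (lift01 σ))) γ =
      pairSign γ σ * fcoef p (reflect σ γ) := by
  have hmp : MeasurePreserving
      (fun y : EuclideanSpace ℝ (Fin d) => reflectReal σ y + halfVec (lift01 σ)) := by
    simpa using measurePreserving_reflect_add σ 0 (halfVec (lift01 σ))
  have hemb : MeasurableEmbedding
      (fun y : EuclideanSpace ℝ (Fin d) => reflectReal σ y + halfVec (lift01 σ)) :=
    ((reflectReal σ).toHomeomorph.trans (Homeomorph.addRight _)).measurableEmbedding
  have h1 := hmp.integral_comp hemb fun z => pairSign γ σ *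
    (Complex.exp (-(2 * Real.pi * (inner ℝ (realVec (reflect σ γ)) z : ℝ) * Complex.I)) * p z)
  rw [fcoef, fcoef, ← integral_const_mul, ← h1]
  refine integral_congr_ae (Filter.Eventually.of_forall fun y => ?_)
  simp only
  rw [← mul_assoc]
  congr 1
  rw [← reflectReal_realVec, inner_reflectReal, map_add, reflectReal_reflectReal, inner_add_right]
  have h2 : inner ℝ (realVec γ) (reflectReal σ (halfVec (lift01 σ))) =
      -(1 / 2) * ((∑ j, γ j * lift01 σ j : ℤ) : ℝ) := by
    rw [inner_realVec]
    push_cast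
    rw [Finset.mul_sum]
    refine Finset.sum_congr rfl fun j _ => ?_
    rw [reflectReal_apply]
    rcases zmod_two_cases (σ j) with h | h
    · simp [lift01, h]
    · simp [lift01, h, show (1 : ZMod 2).val = 1 from rfl]; ring
  rw [h2, pairSign, ← exp_pi_mul_int, ← Complex.exp_add]
  push_cast
  rw [Complex.exp_eq_exp_iff_exists_int]
  refine ⟨-∑ j, γ j * lift01 σ j, ?_⟩
  push_cast
  ring

end Reflections

/-! ### Correlations of windowed functions -/

section Windowed

variable {d k : ℕ}

/-- The product `ḡ · f(· + μ/2)`, whose Fourier coefficients are the coefficients of `f` with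
respect to the shifts `T_{μ/2} M_γ g`. -/
noncomputable def windowed (g : L2 d) (f : EuclideanSpace ℝ (Fin d) → ℂ) (μ : Fin d → ℤ)
    (y : EuclideanSpace ℝ (Fin d)) : ℂ := conj (g y) * f (y + halfVec μ)

theorem measurable_coeFn (g : L2 d) : Measurable g := (Lp.stronglyMeasurable g).measurable

theorem measurable_windowed (g : L2 d) {f : EuclideanSpace ℝ (Fin d) → ℂ} (hf : IsTestFun f)
    (μ : Fin d → ℤ) : Measurable (windowed g f μ) :=
  (Complex.continuous_conj.measurable.comp (measurable_coeFn g)).mul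
    (hf.measurable.comp (measurable_add_const _))

theorem memLp_windowed (g : L2 d) {f : EuclideanSpace ℝ (Fin d) → ℂ} (hf : IsTestFun f)
    (μ : Fin d → ℤ) : MemLp (windowed g f μ) 2 := by
  obtain ⟨M, hM⟩ := hf.bounded
  refine MemLp.of_le_mul (c := M) (Lp.memLp g) (measurable_windowed g hf μ).aestronglyMeasurable
    (Filter.Eventually.of_forall fun y => ?_)
  rw [windowed, norm_mul, RCLike.norm_conj, mul_comm]
  gcongr
  exact hM _

theorem hasBddSupport_comp_add {f : EuclideanSpace ℝ (Fin d) → ℂ} (hf : HasBddSupport f)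
    (a : EuclideanSpace ℝ (Fin d)) : HasBddSupport fun y => f (y + a) := by
  obtain ⟨R, hR⟩ := hf
  refine ⟨R + ‖a‖, fun y hy => ?_⟩
  calc ‖y‖ = ‖(y + a) - a‖ := by simp
    _ ≤ ‖y + a‖ + ‖a‖ := norm_sub_le _ _
    _ ≤ R + ‖a‖ := by gcongr; exact hR _ hy

theorem hasBddSupport_windowed (g : L2 d) {f : EuclideanSpace ℝ (Fin d) → ℂ} (hf : IsTestFun f)
    (μ : Fin d → ℤ) : HasBddSupport (windowed g f μ) := by
  obtain ⟨R, hR⟩ := hasBddSupport_comp_add hf.support (halfVec μ)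
  exact ⟨R, fun y hy => hR y (right_ne_zero_of_mul hy)⟩

/-- The correlation of `windowed g f μ` with its image under `y ↦ R_σ(y + n) + σ/2`. -/
noncomputable def correlation (g : L2 d) (f : EuclideanSpace ℝ (Fin d) → ℂ) (σ : Fin d → ZMod 2)
    (μ n : Fin d → ℤ) : ℂ :=
  ∫ y, windowed g f μ y *
    conj (windowed g f μ (reflectReal σ (y + realVec n) + halfVec (lift01 σ)))

/-- The coefficient of the test function `f` with respect to `T_{μ/2} M_γ g`. -/
noncomputable def gaborCoef (g : L2 d) (f : EuclideanSpace ℝ (Fin d) → ℂ) (μ γ : Fin d → ℤ) : ℂ :=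
  fcoef (windowed g f μ) γ

theorem inner_gabor (g : L2 d) {f : EuclideanSpace ℝ (Fin d) → ℂ} (hf : IsTestFun f)
    (μ γ : Fin d → ℤ) :
    inner ℂ (translateL2 (halfVec μ) (modulateL2 (realVec γ) g)) (hf.memLp.toLp f) =
      gaborCoef g f μ γ :=
  inner_translate_modulate _ _ _ _

/-- Parseval's identity in `γ` for one cross term. -/
theorem hasSum_gaborCoef_mul_conj (g : L2 d) {f : EuclideanSpace ℝ (Fin d) → ℂ} (hf : IsTestFun f)
    (σ : Fin d → ZMod 2) (μ : Fin d → ℤ) :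
    HasSum (fun γ => pairSign γ σ * (gaborCoef g f μ γ * conj (gaborCoef g f μ (reflect σ γ))))
      (∑' n, correlation g f σ μ n) := by
  have hmp : MeasurePreserving
      (fun y : EuclideanSpace ℝ (Fin d) => reflectReal σ y + halfVec (lift01 σ)) := by
    simpa using measurePreserving_reflect_add σ 0 (halfVec (lift01 σ))
  have hq2 : MemLp (fun y => windowed g f μ (reflectReal σ y + halfVec (lift01 σ))) 2 :=
    (memLp_windowed g hf μ).comp_measurePreserving hmp
  have hqb : HasBddSupport (fun y => windowed g f μ (reflectReal σ y + halfVec (lift01 σ))) := by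
    obtain ⟨R, hR⟩ := hasBddSupport_comp_add (hasBddSupport_windowed g hf μ) (halfVec (lift01 σ))
    exact ⟨R, fun y hy => by simpa using hR (reflectReal σ y) hy⟩
  refine (hasSum_fcoef_mul_conj (memLp_windowed g hf μ) hq2 (hasBddSupport_windowed g hf μ)
    hqb).congr_fun fun γ => ?_
  rw [fcoef_reflect_add_half, map_mul, conj_pairSign, gaborCoef, gaborCoef]
  ring

/-- Absolute summability of the correlations: by the arithmetic-geometric mean inequality one factor
`‖g‖²` is integrated, while the sums over `n` and `μ` of the translates of `f` are bounded. -/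
theorem tsum_lintegral_windowed_ne_top (g : L2 d) {f : EuclideanSpace ℝ (Fin d) → ℂ}
    (hf : IsTestFun f) (σ : Fin d → ZMod 2) (t : EuclideanSpace ℝ (Fin d)) :
    ∑' p : (Fin d → ℤ) × (Fin d → ℤ), ∫⁻ y, ‖windowed g f p.1 y‖ₑ *
      ‖windowed g f p.1 (reflectReal σ (y + realVec p.2) + t)‖ₑ ≠ ∞ := by
  obtain ⟨C₁, hC₁, h₁⟩ := hf.tsum_translates_le one_pos
  obtain ⟨C₂, hC₂, h₂⟩ := hf.tsum_translates_le (c := 1 / 2) (by norm_num)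
  simp only [one_smul] at h₁
  set F : EuclideanSpace ℝ (Fin d) → ℝ≥0∞ := fun y => ‖f y‖ₑ with hF
  set W : EuclideanSpace ℝ (Fin d) → ℝ≥0∞ := fun y => ‖g y‖ₑ ^ 2 with hW
  have hFm : Measurable F := hf.measurable.enorm
  have hWm : Measurable W := (measurable_coeFn g).enorm.pow_const 2
  have hWi : ∫⁻ y, W y ≠ ∞ := by
    have h := (Lp.memLp g).eLpNorm_lt_top
    rw [eLpNorm_lt_top_iff_lintegral_rpow_enorm_lt_top (by norm_num) (by norm_num)] at h
    simpa [hW] using h.ne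
  have hR : Measurable (fun y : EuclideanSpace ℝ (Fin d) => reflectReal σ y) :=
    (reflectReal σ).continuous.measurable
  have hT : ∑' μ : Fin d → ℤ, ∫⁻ y, W y * F (y + halfVec μ) * C₁ ≤ (∫⁻ y, W y) * C₂ * C₁ := by
    rw [← lintegral_tsum (fun n => by fun_prop), ← lintegral_mul_const _ hWm,
      ← lintegral_mul_const _ (by fun_prop)]
    refine lintegral_mono fun y => ?_
    simp only
    rw [ENNReal.tsum_mul_right, ENNReal.tsum_mul_left]
    gcongr
    exact h₂ y
  -- the two halves of the arithmetic-geometric mean inequality `‖g y‖ ‖g z‖ ≤ ‖g y‖² + ‖g z‖²`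
  have hA : ∑' p : (Fin d → ℤ) × (Fin d → ℤ), ∫⁻ y, W y * F (y + halfVec p.1) *
      F (reflectReal σ (y + realVec p.2) + t + halfVec p.1) ≤ (∫⁻ y, W y) * C₂ * C₁ := by
    refine (ENNReal.tsum_prod (f := fun μ n : Fin d → ℤ => ∫⁻ y, W y * F (y + halfVec μ) *
      F (reflectReal σ (y + realVec n) + t + halfVec μ))).trans_le ?_
    calc _ ≤ ∑' μ : Fin d → ℤ, ∫⁻ y, W y * F (y + halfVec μ) * C₁ := by
          refine ENNReal.tsum_le_tsum fun μ => ?_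
          rw [← lintegral_tsum (fun n => by fun_prop)]
          refine lintegral_mono fun y => ?_
          simp only
          rw [ENNReal.tsum_mul_left]
          gcongr
          have h3 : ∀ n, reflectReal σ (y + realVec n) + t + halfVec μ =
              (reflectReal σ y + t + halfVec μ) + realVec (reflectEquiv σ n) := by
            intro n
            rw [map_add, reflectReal_realVec]
            change _ = _ + realVec (reflect σ n)
            abel
          simp_rw [h3]
          rw [(reflectEquiv σ).tsum_eq fun n => F (reflectReal σ y + t + halfVec μ + realVec n)]
          exact h₁ _
      _ ≤ _ := hT
  have hB : ∑' p : (Fin d → ℤ) × (Fin d → ℤ), ∫⁻ y,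
      W (reflectReal σ (y + realVec p.2) + t) * F (y + halfVec p.1) *
      F (reflectReal σ (y + realVec p.2) + t + halfVec p.1) ≤ (∫⁻ y, W y) * C₂ * C₁ := by
    refine (ENNReal.tsum_prod (f := fun μ n : Fin d → ℤ => ∫⁻ y,
      W (reflectReal σ (y + realVec n) + t) * F (y + halfVec μ) *
      F (reflectReal σ (y + realVec n) + t + halfVec μ))).trans_le ?_
    have h0 : ∀ μ n : Fin d → ℤ, ∫⁻ y,
        W (reflectReal σ (y + realVec n) + t) * F (y + halfVec μ) *
        F (reflectReal σ (y + realVec n) + t + halfVec μ) =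
        ∫⁻ z, W z * F (z + halfVec μ) *
          F (reflectReal σ (z - t) + halfVec μ + realVec (Equiv.neg _ n)) := by
      intro μ n
      have hmp := measurePreserving_reflect_add σ (realVec n) t
      rw [← hmp.lintegral_comp (f := fun z => W z * F (z + halfVec μ) *
        F (reflectReal σ (z - t) + halfVec μ + realVec (Equiv.neg _ n))) (by fun_prop)]
      refine lintegral_congr fun y => ?_
      have : reflectReal σ (reflectReal σ (y + realVec n) + t - t) + halfVec μ +
          realVec (Equiv.neg _ n) = y + halfVec μ := by
        change _ + realVec (-n) = _
        rw [add_sub_cancel_right, reflectReal_reflectReal, realVec_neg]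
        abel
      rw [this]
      ring
    simp_rw [h0]
    calc _ ≤ ∑' μ : Fin d → ℤ, ∫⁻ y, W y * F (y + halfVec μ) * C₁ := by
          refine ENNReal.tsum_le_tsum fun μ => ?_
          rw [← lintegral_tsum (fun n => by fun_prop)]
          refine lintegral_mono fun y => ?_
          simp only
          rw [ENNReal.tsum_mul_left]
          gcongr
          rw [(Equiv.neg (Fin d → ℤ)).tsum_eq fun n =>
            F (reflectReal σ (y - t) + halfVec μ + realVec n)]
          exact h₁ _
      _ ≤ _ := hT
  have hfin : (∫⁻ y, W y) * C₂ * C₁ ≠ ∞ := ENNReal.mul_ne_top (ENNReal.mul_ne_top hWi hC₂) hC₁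
  refine ne_top_of_le_ne_top (ENNReal.add_ne_top.2 ⟨hfin, hfin⟩)
    (le_trans ?_ (add_le_add hA hB))
  rw [← ENNReal.tsum_add]
  refine ENNReal.tsum_le_tsum fun p => ?_
  rw [← lintegral_add_left (by fun_prop)]
  refine lintegral_mono fun y => ?_
  simp only [windowed, enorm_mul, RCLike.enorm_conj]
  have hag : ∀ a b : ℝ≥0∞, a * b ≤ a ^ 2 + b ^ 2 := by
    intro a b
    rcases le_total a b with h | h
    · exact le_add_left (by rw [sq]; gcongr)
    · exact le_add_right (by rw [sq]; gcongr)
  calc _ = (‖g y‖ₑ * ‖g (reflectReal σ (y + realVec p.2) + t)‖ₑ) *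
        (F (y + halfVec p.1) * F (reflectReal σ (y + realVec p.2) + t + halfVec p.1)) := by
        simp only [hF]; ring
    _ ≤ (W y + W (reflectReal σ (y + realVec p.2) + t)) *
        (F (y + halfVec p.1) * F (reflectReal σ (y + realVec p.2) + t + halfVec p.1)) := by
        gcongr; exact hag _ _
    _ = _ := by ring

theorem summable_norm_correlation (g : L2 d) {f : EuclideanSpace ℝ (Fin d) → ℂ}
    (hf : IsTestFun f) (σ : Fin d → ZMod 2) :
    Summable fun p : (Fin d → ℤ) × (Fin d → ℤ) => ‖correlation g f σ p.1 p.2‖ := by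
  have h := tsum_lintegral_windowed_ne_top g hf σ (halfVec (lift01 σ))
  have h2 : ∑' p : (Fin d → ℤ) × (Fin d → ℤ), ‖correlation g f σ p.1 p.2‖ₑ ≠ ∞ := by
    refine ne_top_of_le_ne_top h (ENNReal.tsum_le_tsum fun p => ?_)
    refine (enorm_integral_le_lintegral_enorm _).trans (lintegral_mono fun y => ?_)
    simp only [enorm_mul, RCLike.enorm_conj]
    exact le_rfl
  have h3 := ENNReal.summable_toReal h2
  simpa using h3

end Windowed

/-! ### Cancellation of the cross terms -/

section CrossTerms

variable {d k : ℕ}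

/-- The involution of `(μ, n)` that cancels the cross terms, for a generator `u` (second component):
`n ↦ 1 - n` on the support of `u`. -/
def swapShift (u : Fin d → ZMod 2) (n : Fin d → ℤ) : Fin d → ℤ :=
  fun j => if u j = 0 then n j else 1 - n j

/-- The involution of `(μ, n)` that cancels the cross terms, for a generator `u` (first component):
`μ ↦ μ + 1 - 2n` on the support of `u`. -/
def swapTrans (u : Fin d → ZMod 2) (μ n : Fin d → ℤ) : Fin d → ℤ :=
  fun j => if u j = 0 then μ j else μ j + 1 - 2 * n j

theorem swapShift_swapShift (u : Fin d → ZMod 2) (n : Fin d → ℤ) :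
    swapShift u (swapShift u n) = n := by
  ext j; by_cases h : u j = 0 <;> simp [swapShift, h]

theorem swapTrans_swapTrans (u : Fin d → ZMod 2) (μ n : Fin d → ℤ) :
    swapTrans u (swapTrans u μ n) (swapShift u n) = μ := by
  ext j; by_cases h : u j = 0 <;> simp [swapTrans, swapShift, h]; ring

theorem intCast_swapTrans (u : Fin d → ZMod 2) (μ n : Fin d → ℤ) :
    (fun j => ((swapTrans u μ n j : ℤ) : ZMod 2)) = (fun j => (μ j : ZMod 2)) + u := by
  ext j
  rcases zmod_two_cases (u j) with h | h <;>
    simp [swapTrans, h, show (2 : ZMod 2) = 0 from rfl]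

/-- A separable function is unchanged, as a product over two points, when the two points exchange
their coordinates in one block. -/
theorem separable_mul_swap {G : AddSubgroup (Fin d → ZMod 2)} {s : Fin k → Fin d → ZMod 2}
    (hG : IsSeparableGroup G s) {g : EuclideanSpace ℝ (Fin d) → ℂ}
    {g₀ : ({j : Fin d // ∀ i, s i j = 0} → ℝ) → ℂ}
    {g' : (i : Fin k) → ({j : Fin d // s i j ≠ 0} → ℝ) → ℂ}
    {x w x' w' : EuclideanSpace ℝ (Fin d)}
    (hx : g x = g₀ (fun j => x j) * ∏ i, g' i (fun j => x j))
    (hw : g w = g₀ (fun j => w j) * ∏ i, g' i (fun j => w j))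
    (hx' : g x' = g₀ (fun j => x' j) * ∏ i, g' i (fun j => x' j))
    (hw' : g w' = g₀ (fun j => w' j) * ∏ i, g' i (fun j => w' j))
    (i : Fin k) (hB : ∀ j, s i j ≠ 0 → x' j = w j ∧ w' j = x j)
    (hC : ∀ j, s i j = 0 → x' j = x j ∧ w' j = w j) : g x' * g w' = g x * g w := by
  have e1 : (fun j : {j : Fin d // ∀ i, s i j = 0} => x' j.1) = fun j => x j.1 :=
    funext fun j => (hC j (j.2 i)).1
  have e2 : (fun j : {j : Fin d // ∀ i, s i j = 0} => w' j.1) = fun j => w j.1 :=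
    funext fun j => (hC j (j.2 i)).2
  rw [hx, hw, hx', hw', e1, e2]
  suffices h : (∏ m, g' m fun j => x' j.1) * (∏ m, g' m fun j => w' j.1) =
      (∏ m, g' m fun j => x j.1) * ∏ m, g' m fun j => w j.1 by
    linear_combination (g₀ fun j => x j.1) * (g₀ fun j => w j.1) * h
  rw [← Finset.prod_mul_distrib, ← Finset.prod_mul_distrib]
  refine Finset.prod_congr rfl fun m _ => ?_
  by_cases hm : m = i
  · subst hm
    have e3 : (fun j : {j : Fin d // s m j ≠ 0} => x' j.1) = fun j => w j.1 :=
      funext fun j => (hB j j.2).1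
    have e4 : (fun j : {j : Fin d // s m j ≠ 0} => w' j.1) = fun j => x j.1 :=
      funext fun j => (hB j j.2).2
    rw [e3, e4, mul_comm]
  · have h0 : ∀ j : {j : Fin d // s m j ≠ 0}, s i j = 0 := fun j => by
      by_contra h
      exact hm (hG.eq_of_ne_zero j.2 h)
    have e3 : (fun j : {j : Fin d // s m j ≠ 0} => x' j.1) = fun j => x j.1 :=
      funext fun j => (hC j (h0 j)).1
    have e4 : (fun j : {j : Fin d // s m j ≠ 0} => w' j.1) = fun j => w j.1 :=
      funext fun j => (hC j (h0 j)).2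
    rw [e3, e4]

/-- The correlations are invariant under the involution attached to a generator contained in `σ`:
exchanging the block of that generator between the two points at which `g` is evaluated amounts to
a translation of the integration variable. -/
theorem correlation_swap {G : AddSubgroup (Fin d → ZMod 2)} {s : Fin k → Fin d → ZMod 2}
    (hG : IsSeparableGroup G s) {g : L2 d} (hg : IsSeparableFun s g)
    (hsymm : ∀ᵐ y, g (-y) = conj (g y)) (f : EuclideanSpace ℝ (Fin d) → ℂ)
    {σ : Fin d → ZMod 2} (i : Fin k) (hi : ∀ j, s i j ≠ 0 → σ j = 1) (μ n : Fin d → ℤ) :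
    correlation g f σ (swapTrans (s i) μ n) (swapShift (s i) n) = correlation g f σ μ n := by
  obtain ⟨g₀, g', hprod⟩ := hg
  set δ : EuclideanSpace ℝ (Fin d) :=
    WithLp.toLp 2 fun j => if s i j = 0 then 0 else (n j : ℝ) - 1 / 2 with hδ
  set v : EuclideanSpace ℝ (Fin d) → EuclideanSpace ℝ (Fin d) :=
    fun y => reflectReal σ (y + realVec n) + halfVec (lift01 σ) with hv
  set v' : EuclideanSpace ℝ (Fin d) → EuclideanSpace ℝ (Fin d) :=
    fun y => reflectReal σ (y + δ + realVec (swapShift (s i) n)) + halfVec (lift01 σ) with hv'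
  have hvm : MeasurePreserving v := measurePreserving_reflect_add σ _ _
  have hvm' : MeasurePreserving v' := by
    have := measurePreserving_reflect_add σ (δ + realVec (swapShift (s i) n)) (halfVec (lift01 σ))
    simpa only [← add_assoc] using this
  have hone : (1 : ZMod 2).val = 1 := rfl
  have hB : ∀ y j, s i j ≠ 0 → (y + δ) j = (-v y) j ∧ (-v' y) j = y j := by
    intro y j hj
    simp only [hδ, hv, hv', PiLp.add_apply, PiLp.neg_apply, PiLp.smul_apply, reflectReal_apply,
      realVec_apply, hi j hj, if_neg hj, swapShift, lift01, hone, smul_eq_mul]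
    push_cast
    constructor <;> ring
  have hC : ∀ y j, s i j = 0 → (y + δ) j = y j ∧ (-v' y) j = (-v y) j := by
    intro y j hj
    simp [hδ, hv, hv', reflectReal_apply, hj, swapShift]
  have h1 : ∀ y, y + δ + halfVec (swapTrans (s i) μ n) = y + halfVec μ := by
    intro y
    ext j
    by_cases hj : s i j = 0
    · simp [hδ, hj, swapTrans]
    · simp [hδ, hj, swapTrans]; ring
  have h2 : ∀ y, v' y + halfVec (swapTrans (s i) μ n) = v y + halfVec μ := by
    intro y
    ext j
    by_cases hj : s i j = 0
    · have := (hC y j hj).2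
      simp only [PiLp.neg_apply, neg_inj] at this
      simp [this, hj, swapTrans]
    · have e1 := (hB y j hj).1
      have e2 := (hB y j hj).2
      simp only [PiLp.neg_apply, PiLp.add_apply, hδ, if_neg hj] at e1 e2
      simp only [PiLp.add_apply, PiLp.smul_apply, realVec_apply, swapTrans, if_neg hj, smul_eq_mul]
      push_cast
      linarith
  rw [correlation, ← integral_add_right_eq_self _ δ]
  refine integral_congr_ae ?_
  have a1 := (measurePreserving_add_right volume δ).quasiMeasurePreserving.ae hprod
  have a2 := ((Measure.measurePreserving_neg volume).comp hvm).quasiMeasurePreserving.ae hprod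
  have a3 := ((Measure.measurePreserving_neg volume).comp hvm').quasiMeasurePreserving.ae hprod
  have a4 := hvm.quasiMeasurePreserving.ae hsymm
  have a5 := hvm'.quasiMeasurePreserving.ae hsymm
  filter_upwards [hprod, a1, a2, a3, a4, a5] with y b0 b1 b2 b3 b4 b5
  have key := separable_mul_swap hG b0 b2 b1 b3 i (hB y) (hC y)
  simp only [Function.comp_apply] at key
  rw [b4, b5] at key
  change windowed g f _ (y + δ) * conj (windowed g f _ (v' y)) =
    windowed g f μ y * conj (windowed g f μ (v y))
  simp only [windowed, h1, h2, map_mul, Complex.conj_conj]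
  have key' := congrArg conj key
  simp only [map_mul, Complex.conj_conj] at key'
  linear_combination (f (y + halfVec μ) * conj (f (v y + halfVec μ))) * key'

theorem summable_gaborCoef_sq (g : L2 d) {f : EuclideanSpace ℝ (Fin d) → ℂ} (hf : IsTestFun f) :
    Summable fun p : (Fin d → ℤ) × (Fin d → ℤ) => ‖gaborCoef g f p.1 p.2‖ ^ 2 := by
  have h1 : ∀ μ, HasSum (fun γ => ‖gaborCoef g f μ γ‖ ^ 2)
      (∑' n, correlation g f 0 μ n).re := by
    intro μ
    refine (Complex.hasSum_re (hasSum_gaborCoef_mul_conj g hf 0 μ)).congr_fun fun γ => ?_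
    rw [pairSign_zero_right, one_mul, reflect_zero, Complex.mul_conj, Complex.ofReal_re,
      Complex.normSq_eq_norm_sq]
  have hs := summable_norm_correlation g hf 0
  rw [summable_prod_of_nonneg fun p => by positivity]
  refine ⟨fun μ => (h1 μ).summable, ?_⟩
  simp only [fun μ => (h1 μ).tsum_eq]
  refine Summable.of_norm_bounded hs.prod fun μ => ?_
  refine (Complex.abs_re_le_norm _).trans (norm_tsum_le_tsum_norm ?_)
  exact hs.prod_factor μ

theorem summable_restrict_lattice (G : AddSubgroup (Fin d → ZMod 2))
    {F : (Fin d → ℤ) × (Fin d → ℤ) → ℝ} (hF : Summable F) :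
    Summable fun p : lattice G × (Fin d → ℤ) => F ((p.1 : Fin d → ℤ), p.2) :=
  hF.comp_injective (Subtype.val_injective.prodMap Function.injective_id)

theorem summable_gaborCoef_mul {G : AddSubgroup (Fin d → ZMod 2)} (g : L2 d)
    {f : EuclideanSpace ℝ (Fin d) → ℂ} (hf : IsTestFun f) (σ τ : Fin d → ZMod 2)
    (c : lattice G × (Fin d → ℤ) → ℂ) (hc : ∀ p, ‖c p‖ = 1) :
    Summable fun p : lattice G × (Fin d → ℤ) => c p *
      (gaborCoef g f p.1 (reflect σ p.2) * conj (gaborCoef g f p.1 (reflect τ p.2))) := by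
  have hs : ∀ ρ : Fin d → ZMod 2, Summable fun p : lattice G × (Fin d → ℤ) =>
      ‖gaborCoef g f p.1 (reflect ρ p.2)‖ ^ 2 := by
    intro ρ
    exact ((Equiv.refl (lattice G)).prodCongr (reflectEquiv ρ)).summable_iff.2
      (summable_restrict_lattice G (summable_gaborCoef_sq g hf))
  refine Summable.of_norm_bounded ((hs σ).add (hs τ)) fun p => ?_
  rw [norm_mul, hc, one_mul, norm_mul, RCLike.norm_conj]
  nlinarith [sq_nonneg (‖gaborCoef g f p.1 (reflect σ p.2)‖ - ‖gaborCoef g f p.1 (reflect τ p.2)‖),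
    sq_nonneg (‖gaborCoef g f p.1 (reflect σ p.2)‖), sq_nonneg ‖gaborCoef g f p.1 (reflect τ p.2)‖]

/-- The cross terms in the expansion of the Wilson coefficients cancel. -/
theorem hasSum_crossTerm {G : AddSubgroup (Fin d → ZMod 2)} {s : Fin k → Fin d → ZMod 2}
    (hG : IsSeparableGroup G s) {rep : DualGroup G → Fin d → ℤ}
    (hrep : ∀ q, QuotientAddGroup.mk (rep q) = q) {g : L2 d} (hg : IsSeparableFun s g)
    (hsymm : ∀ᵐ y, g (-y) = conj (g y)) {f : EuclideanSpace ℝ (Fin d) → ℂ} (hf : IsTestFun f)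
    {σ : Fin d → ZMod 2} (hσ : σ ∈ G) (h0 : σ ≠ 0) :
    HasSum (fun p : lattice G × (Fin d → ℤ) =>
      pairSign (rep (dualHom G s (latticeClass p.1)) + p.2) σ *
        (gaborCoef g f p.1 p.2 * conj (gaborCoef g f p.1 (reflect σ p.2)))) 0 := by
  obtain ⟨i, hi, hiσ, hsign⟩ := hG.exists_generator hrep hσ h0
  have hsum := (summable_gaborCoef_mul (G := G) g hf 0 σ
    (fun p => pairSign (rep (dualHom G s (latticeClass p.1)) + p.2) σ)
    (fun p => norm_pairSign _ _)).hasSum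
  simp only [reflect_zero] at hsum
  have h1 := hsum.prod_fiberwise fun μ => by
    have := (hasSum_gaborCoef_mul_conj g hf σ μ).mul_left
      (pairSign (rep (dualHom G s (latticeClass μ))) σ)
    refine this.congr_fun fun γ => ?_
    rw [pairSign_add_left, mul_assoc]
  -- the absolutely convergent double series of correlations that represents the sum
  set K : lattice G × (Fin d → ℤ) → ℂ := fun p =>
    pairSign (rep (dualHom G s (latticeClass p.1))) σ * correlation g f σ p.1 p.2 with hK
  have hKs : Summable K := by
    have h2 := summable_restrict_lattice G (summable_norm_correlation g hf σ)
    refine Summable.of_norm_bounded h2 fun p => ?_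
    rw [hK, norm_mul, norm_pairSign, one_mul]
  have hmem : ∀ (μ : lattice G) (n : Fin d → ℤ), swapTrans (s i) μ n ∈ lattice G := by
    intro μ n
    change (fun j => ((swapTrans (s i) μ n j : ℤ) : ZMod 2)) ∈ G
    rw [intCast_swapTrans]
    exact G.add_mem μ.2 hi
  let e : lattice G × (Fin d → ℤ) ≃ lattice G × (Fin d → ℤ) :=
    Function.Involutive.toPerm
      (fun p => (⟨swapTrans (s i) p.1 p.2, hmem p.1 p.2⟩, swapShift (s i) p.2)) fun p =>
        Prod.ext (Subtype.ext (swapTrans_swapTrans _ _ _)) (swapShift_swapShift _ _)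
  have hKe : ∀ p, K (e p) = -K p := by
    intro p
    have hcl : latticeClass (e p).1 = latticeClass p.1 + ⟨s i, hi⟩ :=
      Subtype.ext (intCast_swapTrans (s i) p.1 p.2)
    change pairSign (rep (dualHom G s (latticeClass (e p).1))) σ *
      correlation g f σ (swapTrans (s i) p.1 p.2) (swapShift (s i) p.2) = _
    rw [hcl, hsign, correlation_swap hG hg hsymm f i hiσ, neg_mul]
  have hzero : ∑' p, K p = 0 := by
    have h2 := e.tsum_eq K
    simp_rw [hKe] at h2
    rw [tsum_neg] at h2
    exact self_eq_neg.1 h2.symm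
  have h3 : HasSum (fun μ : lattice G => pairSign (rep (dualHom G s (latticeClass μ))) σ *
      ∑' n, correlation g f σ μ n) 0 := by
    have h4 := hKs.hasSum.prod_fiberwise fun μ => (hKs.prod_factor μ).hasSum
    rw [hzero] at h4
    refine h4.congr_fun fun μ => ?_
    simp only [hK]
    rw [tsum_mul_left]
  rw [h1.unique h3] at hsum
  exact hsum

end CrossTerms

/-! ### The energy identity on test functions -/

section WilsonIdentity

variable {d k : ℕ}

/-- The shift `T_{μ/2} M_γ g`. -/
noncomputable def tfShift (g : L2 d) (μ γ : Fin d → ℤ) : L2 d :=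
  translateL2 (halfVec μ) (modulateL2 (realVec γ) g)

/-- The normalising constant `c_γ`. -/
noncomputable def wilsonWeight (k : ℕ) (G : AddSubgroup (Fin d → ZMod 2)) (γ : Fin d → ℤ) : ℝ :=
  ((2 : ℝ) ^ k)⁻¹ * √((orbit G γ).ncard : ℝ)

theorem halfVec_latticeEquiv {G : AddSubgroup (Fin d → ZMod 2)} (l : Fin d → ℤ) (h : G) :
    halfVec (latticeEquiv G (l, h) : Fin d → ℤ) =
      realVec l + halfVec (lift01 (h : Fin d → ZMod 2)) := by
  ext j
  simp [latticeEquiv]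
  ring

theorem wilsonFun_eq (G : AddSubgroup (Fin d → ZMod 2)) [Fintype G]
    (s : Fin k → Fin d → ZMod 2) (rep : DualGroup G → Fin d → ℤ) (g : L2 d) (l : Fin d → ℤ) (h : G)
    (γ : Fin d → ℤ) : wilsonFun G s rep g l h γ = (wilsonWeight k G γ : ℂ) •
      ∑ σ : G, pairSign (rep (dualHom G s h) + γ) σ •
        tfShift g (latticeEquiv G (l, h) : Fin d → ℤ) (reflect σ γ) := by
  have hsmul : ∀ (c : ℝ) (x : L2 d), c • x = (c : ℂ) • x := fun c x =>
    (algebraMap_smul ℂ c x).symm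
  rw [wilsonFun, translateL2_translateL2, ← halfVec_latticeEquiv, ← translateCLM_apply,
    hsmul, map_smul, map_sum]
  simp only [map_smul]
  congr 1
  refine Finset.sum_congr (by ext; simp) fun σ _ => ?_
  rfl

theorem inner_wilsonFun (G : AddSubgroup (Fin d → ZMod 2)) [Fintype G]
    (s : Fin k → Fin d → ZMod 2) (rep : DualGroup G → Fin d → ℤ) (g : L2 d) (l : Fin d → ℤ) (h : G)
    (γ : Fin d → ℤ) {f : EuclideanSpace ℝ (Fin d) → ℂ} (hf : IsTestFun f) :
    inner ℂ (wilsonFun G s rep g l h γ) (hf.memLp.toLp f) = (wilsonWeight k G γ : ℂ) *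
      ∑ σ : G, pairSign (rep (dualHom G s h) + γ) σ *
        gaborCoef g f (latticeEquiv G (l, h) : Fin d → ℤ) (reflect σ γ) := by
  rw [wilsonFun_eq, inner_smul_left, Complex.conj_ofReal, sum_inner]
  congr 1
  refine Finset.sum_congr rfl fun σ _ => ?_
  rw [inner_smul_left, conj_pairSign, tfShift, inner_gabor g hf]

/-- The Wilson coefficient of `f` at the index `(l, h, γ)` with `μ = 2l + h`, without the factor
`c_γ`. -/
noncomputable def signedSum (G : AddSubgroup (Fin d → ZMod 2)) [Fintype G]
    (s : Fin k → Fin d → ZMod 2) (rep : DualGroup G → Fin d → ℤ) (g : L2 d)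
    (f : EuclideanSpace ℝ (Fin d) → ℂ) (p : lattice G × (Fin d → ℤ)) : ℂ :=
  ∑ σ : G, pairSign (rep (dualHom G s (latticeClass p.1)) + p.2) σ *
    gaborCoef g f p.1 (reflect σ p.2)

/-- Up to a sign, the Wilson coefficient depends on `γ` only through its orbit. -/
theorem norm_signedSum_reflect (G : AddSubgroup (Fin d → ZMod 2)) [Fintype G]
    (s : Fin k → Fin d → ZMod 2) (rep : DualGroup G → Fin d → ℤ) (g : L2 d)
    (f : EuclideanSpace ℝ (Fin d) → ℂ) (μ : lattice G) (γ : Fin d → ℤ) (τ : G) :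
    ‖signedSum G s rep g f (μ, reflect τ γ)‖ = ‖signedSum G s rep g f (μ, γ)‖ := by
  have : signedSum G s rep g f (μ, γ) =
      pairSign (rep (dualHom G s (latticeClass μ)) + γ) τ *
        signedSum G s rep g f (μ, reflect τ γ) := by
    rw [signedSum, signedSum, Finset.mul_sum, ← Equiv.sum_comp (Equiv.addRight τ)]
    refine Finset.sum_congr rfl fun σ _ => ?_
    simp only [Equiv.coe_addRight, AddSubgroup.coe_add, reflect_add, pairSign_add_right,
      pairSign_add_left, pairSign_reflect_left]
    ring
  rw [this, norm_mul, norm_pairSign, one_mul]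

/-- Expanding the square gives `2ᵏ` diagonal terms, each equal to the Gabor energy; the other terms
cancel. -/
theorem hasSum_signedSum_sq {G : AddSubgroup (Fin d → ZMod 2)} [Fintype G]
    {s : Fin k → Fin d → ZMod 2}
    (hG : IsSeparableGroup G s) {rep : DualGroup G → Fin d → ℤ}
    (hrep : ∀ q, QuotientAddGroup.mk (rep q) = q) {g : L2 d} (hg : IsSeparableFun s g)
    (hsymm : ∀ᵐ y, g (-y) = conj (g y)) {f : EuclideanSpace ℝ (Fin d) → ℂ} (hf : IsTestFun f) :
    HasSum (fun p : lattice G × (Fin d → ℤ) => ‖signedSum G s rep g f p‖ ^ 2)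
      (2 ^ k * ∑' p : lattice G × (Fin d → ℤ), ‖gaborCoef g f p.1 p.2‖ ^ 2) := by
  classical
  set Q : ℝ := ∑' p : lattice G × (Fin d → ℤ), ‖gaborCoef g f p.1 p.2‖ ^ 2 with hQ
  have hQs := summable_restrict_lattice G (summable_gaborCoef_sq g hf)
  -- the diagonal terms sum to `Q`, the off-diagonal ones cancel
  have hterm : ∀ σ τ : G, HasSum (fun p : lattice G × (Fin d → ℤ) =>
      (pairSign (rep (dualHom G s (latticeClass p.1)) + p.2) σ *
        gaborCoef g f p.1 (reflect σ p.2)) *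
      conj (pairSign (rep (dualHom G s (latticeClass p.1)) + p.2) τ *
        gaborCoef g f p.1 (reflect τ p.2))) (if τ = σ then (Q : ℂ) else 0) := by
    intro σ τ
    have h1 : HasSum (fun p : lattice G × (Fin d → ℤ) =>
        pairSign (rep (dualHom G s (latticeClass p.1)) + p.2) ((τ : Fin d → ZMod 2) + σ) *
          (gaborCoef g f p.1 p.2 * conj (gaborCoef g f p.1
            (reflect ((τ : Fin d → ZMod 2) + σ) p.2)))) (if τ = σ then (Q : ℂ) else 0) := by
      split_ifs with h
      · subst h
        simp only [zmod_two_add_self, pairSign_zero_right, reflect_zero, one_mul, Complex.mul_conj,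
          Complex.normSq_eq_norm_sq]
        exact_mod_cast hQs.hasSum
      · refine hasSum_crossTerm hG hrep hg hsymm hf (G.add_mem τ.2 σ.2) fun h0 => h ?_
        refine Subtype.ext ?_
        rw [eq_neg_of_add_eq_zero_left h0]
        exact neg_eq_of_add_eq_zero_left (zmod_two_add_self _)
    refine (((Equiv.refl (lattice G)).prodCongr (reflectEquiv σ)).hasSum_iff.2 h1).congr_fun
      fun p => ?_
    have e1 : ((Equiv.refl (lattice G)).prodCongr (reflectEquiv σ)) p =
      (p.1, reflect σ p.2) := rfl
    simp only [Function.comp_apply, e1, reflect_add, reflect_reflect, pairSign_add_right,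
      pairSign_add_left, pairSign_reflect_left, map_mul, conj_pairSign]
    ring
  have hall := hasSum_sum (s := (Finset.univ : Finset G)) fun σ _ =>
    hasSum_sum (s := (Finset.univ : Finset G)) fun τ _ => hterm σ τ
  simp only [Finset.sum_ite_eq', Finset.mem_univ, if_true, Finset.sum_const, Finset.card_univ,
    ← Nat.card_eq_fintype_card, hG.card_eq] at hall
  have hfin : HasSum (fun p : lattice G × (Fin d → ℤ) =>
      ((‖signedSum G s rep g f p‖ ^ 2 : ℝ) : ℂ)) ((2 ^ k * Q : ℝ) : ℂ) := by
    have e2 : ((2 ^ k * Q : ℝ) : ℂ) = (2 ^ k) • (Q : ℂ) := by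
      simp
    rw [e2]
    refine hall.congr_fun fun p => ?_
    rw [← Complex.normSq_eq_norm_sq, ← Complex.mul_conj, signedSum, map_sum, Finset.sum_mul_sum]
  exact_mod_cast hfin

/-- On test functions, the Wilson coefficients carry `2⁻ᵏ` times the energy of the Gabor
coefficients. -/
theorem hasSum_wilson_sq {G : AddSubgroup (Fin d → ZMod 2)}
    {s : Fin k → Fin d → ZMod 2}
    (hG : IsSeparableGroup G s) {rep : DualGroup G → Fin d → ℤ}
    (hrep : ∀ q, QuotientAddGroup.mk (rep q) = q)
    {N : Set (Fin d → ℤ)} (hN : ∀ x : Fin d → ℤ, (N ∩ orbit G x).ncard = 1)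
    {g : L2 d} (hg : IsSeparableFun s g)
    (hsymm : ∀ᵐ y, g (-y) = conj (g y)) {f : EuclideanSpace ℝ (Fin d) → ℂ} (hf : IsTestFun f) :
    HasSum (fun i => ‖inner ℂ (wilsonSystem G s rep N g i) (hf.memLp.toLp f)‖ ^ 2)
      (((2 : ℝ) ^ k)⁻¹ * ∑' p : lattice G × (Fin d → ℤ), ‖gaborCoef g f p.1 p.2‖ ^ 2) := by
  classical
  have : Fintype G := Fintype.ofFinite G
  obtain ⟨r, hr⟩ := exists_representative hN
  set Q : ℝ := ∑' p : lattice G × (Fin d → ℤ), ‖gaborCoef g f p.1 p.2‖ ^ 2 with hQ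
  have h1 := hasSum_signedSum_sq hG hrep hg hsymm hf
  rw [← hQ] at h1
  have h2 := h1.tsum_fiberwise fun p : lattice G × (Fin d → ℤ) => (p.1, r p.2)
  -- each fibre is the orbit of its representative, on which the summand is constant
  have h3 : ∀ q : lattice G × N, ∑' p : (fun p : lattice G × (Fin d → ℤ) => (p.1, r p.2)) ⁻¹' {q},
      ‖signedSum G s rep g f p‖ ^ 2 =
        (orbit G (q.2 : Fin d → ℤ)).ncard * ‖signedSum G s rep g f (q.1, q.2)‖ ^ 2 := by
    rintro ⟨μ, n⟩
    let e : orbit G (n : Fin d → ℤ) ≃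
        (fun p : lattice G × (Fin d → ℤ) => (p.1, r p.2)) ⁻¹' {(μ, n)} :=
      { toFun := fun x => ⟨(μ, x), by
          simpa using (hr x n).2 x.2⟩
        invFun := fun p => ⟨p.1.2, (hr p.1.2 n).1 (congrArg Prod.snd p.2)⟩
        left_inv := fun x => rfl
        right_inv := fun p => Subtype.ext (Prod.ext (congrArg Prod.fst p.2).symm rfl) }
    rw [← e.tsum_eq]
    have h4 : ∀ x : orbit G (n : Fin d → ℤ), ‖signedSum G s rep g f (e x : _)‖ ^ 2 =
        ‖signedSum G s rep g f (μ, n)‖ ^ 2 := by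
      rintro ⟨x, τ, hτ, rfl⟩
      exact congrArg (· ^ 2) (norm_signedSum_reflect G s rep g f μ n ⟨τ, hτ⟩)
    simp only [h4]
    rw [tsum_const, nsmul_eq_mul, Nat.card_coe_set_eq]
  simp_rw [h3] at h2
  have h5 := ((((latticeEquiv G).prodCongr (Equiv.refl N)).hasSum_iff.2 h2).mul_left
    ((((2 : ℝ) ^ k)⁻¹) ^ 2))
  have h6 := (Equiv.prodAssoc (Fin d → ℤ) G N).symm.hasSum_iff.2 h5
  have e0 : (((2 : ℝ) ^ k)⁻¹) ^ 2 * (2 ^ k * Q) = ((2 : ℝ) ^ k)⁻¹ * Q := by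
    field_simp
  rw [e0] at h6
  have h7 : HasSum (fun p : (Fin d → ℤ) × G × N =>
      ‖inner ℂ (wilsonFun G s rep g p.1 p.2.1 p.2.2) (hf.memLp.toLp f)‖ ^ 2)
      (((2 : ℝ) ^ k)⁻¹ * Q) := by
    refine h6.congr_fun fun p => ?_
    obtain ⟨l, h, n⟩ := p
    rw [inner_wilsonFun G s rep g l h n hf, norm_mul, mul_pow, Complex.norm_real, Real.norm_eq_abs,
      sq_abs, wilsonWeight, mul_pow, Real.sq_sqrt (Nat.cast_nonneg _)]
    simp only [Function.comp_apply, Equiv.prodAssoc_symm_apply, Equiv.prodCongr_apply,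
      Prod.map_apply, Equiv.refl_apply, signedSum, latticeClass_latticeEquiv]
    ring
  have h8 : Function.support (fun p : (Fin d → ℤ) × G × N =>
      ‖inner ℂ (wilsonFun G s rep g p.1 p.2.1 p.2.2) (hf.memLp.toLp f)‖ ^ 2) ⊆
      {p | wilsonFun G s rep g p.1 p.2.1 p.2.2 ≠ 0} := by
    intro p hp h0
    exact hp (by simp [h0])
  exact (hasSum_subtype_iff_of_support_subset h8).2 h7

end WilsonIdentity

/-! ### Passing from a dense set to all of the space -/

section Comparison

variable {ι κ H : Type*} [NormedAddCommGroup H] [InnerProductSpace ℂ H]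

/-- On the dense set `D` the coefficients of `ψ` carry `c⁻¹` times the energy of those of `φ`. -/
def IsEnergyScaled (D : Set H) (φ : ι → H) (ψ : κ → H) (c : ℝ) : Prop :=
  ∀ f ∈ D, ∃ q : ℝ, HasSum (fun i => ‖inner ℂ (φ i) f‖ ^ 2) q ∧
    HasSum (fun i => ‖inner ℂ (ψ i) f‖ ^ 2) (c⁻¹ * q)

theorem IsEnergyScaled.isBessel_iff {D : Set H} {φ : ι → H} {ψ : κ → H} {c : ℝ}
    (h : IsEnergyScaled D φ ψ c) (hD : Dense D) (hc : 0 < c) (b : ℝ) :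
    IsBessel φ b ↔ IsBessel ψ (c⁻¹ * b) := by
  constructor <;> intro hB <;> refine IsBessel.of_dense hD fun f hf => ?_ <;>
    obtain ⟨q, h1, h2⟩ := h f hf
  · refine ⟨h2.summable, ?_⟩
    have := (hB f).2
    rw [h1.tsum_eq] at this
    rw [h2.tsum_eq, mul_assoc]
    gcongr
  · refine ⟨h1.summable, ?_⟩
    have := (hB f).2
    rw [h2.tsum_eq, mul_assoc] at this
    rw [h1.tsum_eq]
    exact le_of_mul_le_mul_left this (inv_pos.2 hc)

theorem IsFrameOperator.inner_self_eq_re {φ : ι → H} {S : H →L[ℂ] H} (hS : IsFrameOperator φ S)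
    (f : H) : inner ℂ (S f) f = (((inner ℂ f (S f)).re : ℝ) : ℂ) := by
  rw [hS.inner_left]
  refine Complex.ext rfl ?_
  have h1 := congrArg Complex.im (inner_conj_symm f (S f))
  rw [hS.inner_left, Complex.conj_im] at h1
  rw [Complex.ofReal_im]
  linarith

theorem IsEnergyScaled.frameOperator_eq {D : Set H} {φ : ι → H} {ψ : κ → H} {c : ℝ}
    (h : IsEnergyScaled D φ ψ c) (hD : Dense D) (hc : 0 < c) {S T : H →L[ℂ] H}
    (hS : IsFrameOperator φ S) (hT : IsFrameOperator ψ T) : S = (c : ℂ) • T := by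
  have hre : ∀ f, (inner ℂ f (S f)).re = c * (inner ℂ f (T f)).re := by
    have h1 : (fun f => (inner ℂ f (S f)).re) = fun f => c * (inner ℂ f (T f)).re := by
      refine Continuous.ext_on hD (by fun_prop) (by fun_prop) fun f hf => ?_
      obtain ⟨q, h1, h2⟩ := h f hf
      rw [(hS.hasSum_norm_sq f).unique h1, (hT.hasSum_norm_sq f).unique h2,
        mul_inv_cancel_left₀ hc.ne']
    exact fun f => congrFun h1 f
  have h2 : (S : H →ₗ[ℂ] H) = ((c : ℂ) • T : H →L[ℂ] H) := by
    rw [← ext_inner_map]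
    intro f
    change inner ℂ (S f) f = inner ℂ ((c : ℂ) • T f) f
    rw [inner_smul_left, Complex.conj_ofReal, hS.inner_self_eq_re, hT.inner_self_eq_re, hre]
    push_cast
    ring
  exact ContinuousLinearMap.coe_injective h2

theorem IsEnergyScaled.isFrame_iff [CompleteSpace H] [Nontrivial H] {D : Set H} {φ : ι → H}
    {ψ : κ → H} {c : ℝ} (h : IsEnergyScaled D φ ψ c) (hD : Dense D) (hc : 0 < c) (a b : ℝ) :
    IsFrame φ a b ↔ IsFrame ψ (c⁻¹ * a) (c⁻¹ * b) := by
  have hci := inv_pos.2 hc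
  rw [IsFrame, IsFrame, h.isBessel_iff hD hc b, mul_pos_iff_of_pos_left hci]
  refine and_congr_right fun _ => and_congr_right fun hB => forall_congr' fun f => ?_
  obtain ⟨T, hT⟩ := hB.exists_frameOperator
  obtain ⟨S, hS⟩ := ((h.isBessel_iff hD hc b).2 hB).exists_frameOperator
  have hST := h.frameOperator_eq hD hc hS hT
  rw [(hS.hasSum_norm_sq f).tsum_eq, (hT.hasSum_norm_sq f).tsum_eq, hST,
    smul_apply, inner_smul_right, Complex.re_ofReal_mul, mul_assoc,
    inv_mul_le_iff₀ hc]

end Comparison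

section Density

variable {d k : ℕ}

/-- The classes in `L²` of the test functions. -/
def testFunctions (d : ℕ) : Set (L2 d) := {F | ∃ f, ∃ hf : IsTestFun f, F = hf.memLp.toLp f}

theorem dense_testFunctions : Dense (testFunctions d) := by
  rw [Metric.dense_iff]
  intro F ε hε
  obtain ⟨f, hfc, hle, hcont, hmem⟩ := (Lp.memLp F).exists_hasCompactSupport_eLpNorm_sub_le
    (by norm_num) (ε := ENNReal.ofReal (ε / 2)) (by simpa using hε)
  have hf : IsTestFun f :=
    { measurable := hcont.measurable
      bounded := by
        obtain ⟨C, hC⟩ := hfc.exists_bound_of_continuous hcont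
        exact ⟨C, hC⟩
      support := by
        obtain ⟨R, hR⟩ := hfc.isBounded.subset_closedBall 0
        exact ⟨R, fun y hy => by simpa using hR (subset_tsupport f hy)⟩ }
  refine ⟨hf.memLp.toLp f, ?_, f, hf, rfl⟩
  rw [Metric.mem_ball, dist_comm, dist_eq_norm, Lp.norm_def]
  have h1 : eLpNorm (F - hf.memLp.toLp f : L2 d) 2 volume = eLpNorm (⇑F - f) 2 volume := by
    refine eLpNorm_congr_ae ?_
    filter_upwards [Lp.coeFn_sub F (hf.memLp.toLp f), hf.memLp.coeFn_toLp] with x h2 h3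
    rw [h2, Pi.sub_apply, Pi.sub_apply, h3]
  rw [h1]
  calc _ ≤ (ENNReal.ofReal (ε / 2)).toReal := ENNReal.toReal_mono (by simp) hle
    _ = ε / 2 := ENNReal.toReal_ofReal (by positivity)
    _ < ε := by linarith

theorem isTestFun_unitCube : IsTestFun ((unitCube d).indicator fun _ => (1 : ℂ)) where
  measurable := measurable_const.indicator measurableSet_unitCube
  bounded := ⟨1, fun x => by by_cases h : x ∈ unitCube d <;> simp [h]⟩
  support := by
    refine ⟨√d, fun y hy => ?_⟩
    have h : y ∈ unitCube d := by
      by_contra h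
      exact hy (by simp [h])
    rw [EuclideanSpace.norm_eq]
    refine Real.sqrt_le_sqrt ?_
    calc _ ≤ ∑ _i : Fin d, (1 : ℝ) := Finset.sum_le_sum fun i _ => by
          rw [Real.norm_eq_abs, sq_abs]
          have := h i
          nlinarith [this.1, this.2]
      _ = d := by simp

/-- The class in `L²` of the indicator function of the unit cube. -/
noncomputable def cubeL2 (d : ℕ) : L2 d := (isTestFun_unitCube (d := d)).memLp.toLp _

theorem volume_unitCube : volume (unitCube d) = 1 := by
  have h4 : (@WithLp.toLp 2 (Fin d → ℝ) ⁻¹' unitCube d) =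
      Set.univ.pi fun _ => Set.Ioc (0 : ℝ) 1 := by
    ext; simp [unitCube, Set.mem_pi]
  rw [← (PiLp.volume_preserving_toLp (Fin d)).measure_preimage
    measurableSet_unitCube.nullMeasurableSet, h4, volume_pi_pi]
  simp

instance : Nontrivial (L2 d) := by
  refine ⟨cubeL2 d, 0, fun h => ?_⟩
  have h1 : ((unitCube d).indicator fun _ => (1 : ℂ)) =ᵐ[volume] 0 := by
    have h2 := (isTestFun_unitCube (d := d)).memLp.coeFn_toLp
    have h3 := Lp.coeFn_zero ℂ 2 (volume : Measure (EuclideanSpace ℝ (Fin d)))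
    rw [← h] at h3
    exact h2.symm.trans h3
  have h4 : volume (unitCube d) = 0 := by
    refine measure_mono_null (fun x hx => ?_) h1
    simp [hx]
  rw [volume_unitCube] at h4
  exact one_ne_zero h4

theorem isEnergyScaled_gabor_wilson {G : AddSubgroup (Fin d → ZMod 2)}
    {s : Fin k → Fin d → ZMod 2}
    (hG : IsSeparableGroup G s) {rep : DualGroup G → Fin d → ℤ}
    (hrep : ∀ q, QuotientAddGroup.mk (rep q) = q)
    {N : Set (Fin d → ℤ)} (hN : ∀ x : Fin d → ℤ, (N ∩ orbit G x).ncard = 1)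
    {g : L2 d} (hg : IsSeparableFun s g) (hsymm : ∀ᵐ y, g (-y) = conj (g y)) :
    IsEnergyScaled (testFunctions d) (gaborSystem G g) (wilsonSystem G s rep N g) (2 ^ k) := by
  rintro _ ⟨f, hf, rfl⟩
  refine ⟨_, ?_, hasSum_wilson_sq hG hrep hN hg hsymm hf⟩
  have hs : Summable fun p : lattice G × (Fin d → ℤ) => ‖gaborCoef g f p.1 p.2‖ ^ 2 := by
    have := summable_gaborCoef_mul (G := G) g hf 0 0 (fun _ => 1) (by simp)
    refine this.norm.congr fun p => ?_
    simp [sq]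
  refine hs.hasSum.congr_fun fun p => ?_
  rw [gaborSystem, inner_gabor g hf]

end Density

/-! ### Biorthogonality of the window and its canonical dual -/

section Duality

variable {d k : ℕ}

/-- Only the term `n = 0` survives in Parseval's identity for a window supported in a unit cube. -/
theorem hasSum_gaborCoef_unitCube_frequency (u v : L2 d) (μ : Fin d → ℤ) :
    HasSum (fun γ => gaborCoef u ((unitCube d).indicator fun _ => 1) μ γ *
      conj (gaborCoef v ((unitCube d).indicator fun _ => 1) μ γ))
      (∫ y in (fun y => y + halfVec μ) ⁻¹' unitCube d, conj (u y) * v y) := by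
  have hf := isTestFun_unitCube (d := d)
  have h1 := hasSum_fcoef_mul_conj (memLp_windowed u hf μ) (memLp_windowed v hf μ)
    (hasBddSupport_windowed u hf μ) (hasBddSupport_windowed v hf μ)
  have hm : MeasurableSet ((fun y => y + halfVec μ) ⁻¹' unitCube d) :=
    (measurable_add_const _) measurableSet_unitCube
  rw [tsum_eq_single (0 : Fin d → ℤ)] at h1
  · rw [← integral_indicator hm]
    refine (congrArg (HasSum _) (integral_congr_ae (Filter.Eventually.of_forall fun y => ?_))).mp h1
    by_cases hy : y + halfVec μ ∈ unitCube d
    · simp [windowed, realVec_zero, hy]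
    · simp [windowed, realVec_zero, hy]
  · intro n hn
    refine integral_eq_zero_of_ae (Filter.Eventually.of_forall fun y => ?_)
    by_cases hy : y + halfVec μ ∈ unitCube d
    · have h2 : y + realVec n + halfVec μ ∉ unitCube d := by
        intro h2
        have h3 := cubeIndex_add_realVec hy n
        have h4 := cubeIndex_add_realVec h2 0
        rw [realVec_zero, add_zero] at h4
        have h5 : y + realVec n + halfVec μ = y + halfVec μ + realVec n := by abel
        rw [h5, h3] at h4
        exact hn h4
      simp [windowed, h2]
    · simp [windowed, hy]

theorem integrable_conj_mul (u v : L2 d) : Integrable fun y => conj (u y) * v y :=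
  (memLp_conj (Lp.memLp u)).integrable_mul (Lp.memLp v)

/-- The shifts of the unit cube indicator by one coset `h/2 + ℤᵈ` and all integer frequencies form
an orthonormal basis; summing Parseval's identity over the `2ᵏ` cosets gives the factor `2ᵏ`. -/
theorem hasSum_gaborCoef_unitCube {G : AddSubgroup (Fin d → ZMod 2)}
    {s : Fin k → Fin d → ZMod 2} (hG : IsSeparableGroup G s) (u v : L2 d) :
    HasSum (fun p : lattice G × (Fin d → ℤ) =>
      gaborCoef u ((unitCube d).indicator fun _ => 1) p.1 p.2 *
      conj (gaborCoef v ((unitCube d).indicator fun _ => 1) p.1 p.2)) (2 ^ k * inner ℂ u v) := by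
  classical
  have : Fintype G := Fintype.ofFinite G
  have hf := isTestFun_unitCube (d := d)
  have hsq : ∀ w : L2 d, Summable fun p : lattice G × (Fin d → ℤ) =>
      ‖gaborCoef w ((unitCube d).indicator fun _ => 1) p.1 p.2‖ ^ 2 := fun w =>
    summable_restrict_lattice G (summable_gaborCoef_sq w hf)
  have hs : Summable (fun p : lattice G × (Fin d → ℤ) =>
      gaborCoef u ((unitCube d).indicator fun _ => 1) p.1 p.2 *
      conj (gaborCoef v ((unitCube d).indicator fun _ => 1) p.1 p.2)) := by
    refine Summable.of_norm_bounded ((hsq u).add (hsq v)) fun p => ?_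
    rw [norm_mul, RCLike.norm_conj]
    nlinarith [sq_nonneg (‖gaborCoef u ((unitCube d).indicator fun _ => 1) p.1 p.2‖ -
      ‖gaborCoef v ((unitCube d).indicator fun _ => 1) p.1 p.2‖),
      sq_nonneg ‖gaborCoef u ((unitCube d).indicator fun _ => 1) p.1 p.2‖,
      sq_nonneg ‖gaborCoef v ((unitCube d).indicator fun _ => 1) p.1 p.2‖]
  have h1 := hs.hasSum.prod_fiberwise fun μ => hasSum_gaborCoef_unitCube_frequency u v μ
  have h2 := ((Equiv.prodComm G (Fin d → ℤ)).trans (latticeEquiv G)).hasSum_iff.2 h1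
  have h3 : ∀ h : G, HasSum (fun l : Fin d → ℤ => ∫ y in
      (fun y => y + halfVec (latticeEquiv G (l, h) : Fin d → ℤ)) ⁻¹' unitCube d,
        conj (u y) * v y) (inner ℂ u v) := by
    intro h
    have e : inner ℂ u v = ∫ y, conj (u y) * v y := by
      rw [L2.inner_def]
      simp only [RCLike.inner_apply, mul_comm]
    have hU : (⋃ l : Fin d → ℤ,
        (fun y => y + halfVec (latticeEquiv G (l, h) : Fin d → ℤ)) ⁻¹' unitCube d) = Set.univ := by
      refine Set.eq_univ_of_forall fun y => Set.mem_iUnion.2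
        ⟨-cubeIndex (y + halfVec (lift01 (h : Fin d → ZMod 2))), ?_⟩
      rw [Set.mem_preimage, halfVec_latticeEquiv, realVec_neg]
      have := sub_realVec_mem_unitCube.2
        (rfl : cubeIndex (y + halfVec (lift01 (h : Fin d → ZMod 2))) = _)
      convert! this using 1
      abel
    rw [e, ← setIntegral_univ, ← hU]
    refine hasSum_integral_iUnion (fun l => (measurable_add_const _) measurableSet_unitCube) ?_
      (integrable_conj_mul u v).integrableOn
    intro l l' hl
    refine Set.disjoint_left.2 fun y hy hy' => hl ?_
    rw [Set.mem_preimage, halfVec_latticeEquiv] at hy hy'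
    have e1 := cubeIndex_add_realVec hy (-l)
    have e2 := cubeIndex_add_realVec hy' (-l')
    rw [realVec_neg] at e1 e2
    have e3 : y + (realVec l + halfVec (lift01 (h : Fin d → ZMod 2))) + -realVec l =
        y + (realVec l' + halfVec (lift01 (h : Fin d → ZMod 2))) + -realVec l' := by abel
    rw [e3, e2] at e1
    exact (neg_injective e1).symm
  have h4 := h2.prod_fiberwise h3
  have h5 := h4.unique (hasSum_fintype _)
  rw [Finset.sum_const, Finset.card_univ, ← Nat.card_eq_fintype_card, hG.card_eq,
    nsmul_eq_mul] at h5
  push_cast at h5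
  rw [← h5]
  exact hs.hasSum

theorem inner_cubeL2_modulateL2 (β : Fin d → ℤ) :
    inner ℂ (modulateL2 (realVec β) (cubeL2 d)) (cubeL2 d) = if β = 0 then 1 else 0 := by
  have hf := isTestFun_unitCube (d := d)
  have h1 := inner_translate_modulate 0 β (cubeL2 d) hf.memLp
  have ht : translateL2 0 (modulateL2 (realVec β) (cubeL2 d)) =
      modulateL2 (realVec β) (cubeL2 d) := by
    refine Lp.ext ?_
    filter_upwards [coeFn_translateL2 0 (modulateL2 (realVec β) (cubeL2 d))] with x hx
    rw [hx, sub_zero]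
  rw [ht] at h1
  change inner ℂ (modulateL2 (realVec β) (cubeL2 d)) (cubeL2 d) = _ at h1
  rw [h1, fcoef_congr (q := (unitCube d).indicator ((unitCube d).indicator fun _ => (1 : ℂ))),
    fcoef_indicator_unitCube hf.memLp]
  · have hmem : ∀ t : UnitAddTorus (Fin d), torusRep t ∈ unitCube d := by
      intro t i
      have := (UnitAddTorus.measurableEquivPiIoc (fun _ : Fin d => (0 : ℝ)) t).2 i
      simpa using! this
    have h2 : ((unitCube d).indicator fun _ => (1 : ℂ)) ∘ torusRep =
        UnitAddTorus.mFourier (0 : Fin d → ℤ) := by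
      ext t
      simp [hmem t, UnitAddTorus.mFourier_zero]
    rw [h2]
    have h3 := orthonormal_iff_ite.1 (UnitAddTorus.orthonormal_mFourier (d := Fin d)) β 0
    rw [← h3, ContinuousMap.inner_toLp, UnitAddTorus.mFourierCoeff]
    refine integral_congr_ae (Filter.Eventually.of_forall fun t => ?_)
    simp only [UnitAddTorus.mFourier_neg, smul_eq_mul]
    ring
  · filter_upwards [hf.memLp.coeFn_toLp] with y hy
    have : (cubeL2 d) y = (unitCube d).indicator (fun _ => (1 : ℂ)) y := hy
    rw [this]
    by_cases h : y ∈ unitCube d <;> simp [h]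

/-- The Gabor frame operator commutes with the shifts of the system. -/
theorem frameOperator_tfShift {G : AddSubgroup (Fin d → ZMod 2)} {g : L2 d} {S : L2 d →L[ℂ] L2 d}
    (hS : IsFrameOperator (gaborSystem G g) S) (f : L2 d) (μ : lattice G) (γ : Fin d → ℤ) :
    S (tfShift f μ γ) = tfShift (S f) μ γ := by
  have h1 : ∀ f, S (modulateL2 (realVec γ) f) = modulateL2 (realVec γ) (S f) := by
    refine hS.comm_of_permutes (modulateCLM (realVec γ)) (inner_modulateL2 _)
      ((Equiv.refl (lattice G)).prodCongr (Equiv.addLeft γ))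
      (fun p => Complex.exp (2 * Real.pi * (inner ℝ (realVec γ) (halfVec p.1) : ℝ) * Complex.I))
      (fun p => ?_) fun p => ?_
    · have h := Complex.norm_exp_ofReal_mul_I
        (2 * Real.pi * (inner ℝ (realVec γ) (halfVec p.1) : ℝ))
      push_cast at h
      exact h
    · change modulateL2 (realVec γ) (translateL2 (halfVec p.1) (modulateL2 (realVec p.2) g)) =
        _ • translateL2 (halfVec p.1) (modulateL2 (realVec (γ + p.2)) g)
      rw [modulateL2_translateL2, modulateL2_modulateL2, realVec_add]
  have h2 : ∀ f, S (translateL2 (halfVec μ) f) = translateL2 (halfVec μ) (S f) := by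
    refine hS.comm_of_permutes (translateCLM (halfVec μ)) (inner_translateL2 _)
      ((Equiv.addLeft μ).prodCongr (Equiv.refl _)) (fun _ => 1) (by simp) fun p => ?_
    change translateL2 (halfVec μ) (translateL2 (halfVec p.1) (modulateL2 (realVec p.2) g)) =
        (1 : ℂ) • translateL2 (halfVec ((μ : Fin d → ℤ) + (p.1 : Fin d → ℤ)))
          (modulateL2 (realVec p.2) g)
    rw [translateL2_translateL2, one_smul, halfVec, halfVec, halfVec, realVec_add, smul_add]
  rw [tfShift, h2, h1, tfShift]

/-- Modulations by even frequencies commute with shifts by half integers. -/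
theorem modulateL2_tfShift (g : L2 d) (μ γ δ : Fin d → ℤ) :
    modulateL2 (realVec (δ + δ)) (tfShift g μ γ) =
      tfShift (modulateL2 (realVec (δ + δ)) g) μ γ := by
  rw [tfShift, modulateL2_translateL2, modulateL2_modulateL2, tfShift, modulateL2_modulateL2,
    add_comm (realVec (δ + δ))]
  have : Complex.exp (2 * Real.pi * (inner ℝ (realVec (δ + δ)) (halfVec μ) : ℝ) *
      Complex.I) = 1 := by
    rw [Complex.exp_eq_one_iff]
    refine ⟨∑ j, δ j * μ j, ?_⟩
    rw [inner_smul_right, inner_realVec]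
    have : (1 / 2 : ℝ) * ∑ i, ((δ + δ) i : ℝ) * realVec μ i = ((∑ j, δ j * μ j : ℤ) : ℝ) := by
      push_cast
      rw [Finset.mul_sum]
      refine Finset.sum_congr rfl fun j _ => ?_
      simp only [Pi.add_apply, realVec_apply]
      push_cast
      ring
    rw [this]
    push_cast
    ring
  rw [this, one_smul]

/-- Biorthogonality of the window `g` and its canonical dual `gd` along even frequencies. Modulation
by an even frequency commutes with the shifts `T_{μ/2} M_γ`, so the reconstruction formula for the
indicator of the unit cube, tested against its modulations, can be evaluated by
`hasSum_gaborCoef_unitCube`. -/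
theorem inner_modulate_dual {G : AddSubgroup (Fin d → ZMod 2)}
    {s : Fin k → Fin d → ZMod 2} (hG : IsSeparableGroup G s) {g gd : L2 d} {S : L2 d →L[ℂ] L2 d}
    (hS : IsFrameOperator (gaborSystem G g) S) (hsurj : Function.Surjective S) (hgd : S gd = g)
    (δ : Fin d → ℤ) : inner ℂ (modulateL2 (realVec (δ + δ)) g) gd =
      if δ = 0 then ((2 : ℂ) ^ k)⁻¹ else 0 := by
  have hf := isTestFun_unitCube (d := d)
  obtain ⟨y, hy⟩ := hsurj (cubeL2 d)
  have h1 := hS.hasSum_inner y (modulateL2 (realVec (-(δ + δ))) (cubeL2 d))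
  rw [hy, inner_cubeL2_modulateL2] at h1
  have h2 := hasSum_gaborCoef_unitCube hG gd (modulateL2 (realVec (δ + δ)) g)
  have h3 := h2.unique (h1.congr_fun fun p => ?_)
  · rw [← inner_conj_symm, ← (mul_right_injective₀ (pow_ne_zero k (two_ne_zero' ℂ))).eq_iff]
    have h4 := congrArg conj h3
    rw [map_mul, map_pow, map_ofNat] at h4
    rw [h4]
    have h5 : -(δ + δ) = 0 ↔ δ = 0 := by
      rw [neg_eq_zero]
      exact ⟨fun h => funext fun j => by have := congrFun h j; simp at this; omega,
        fun h => by simp [h]⟩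
    by_cases h0 : δ = 0
    · simp [h0]
    · rw [if_neg (mt h5.1 h0), if_neg h0, map_zero, mul_zero]
  · have e1 : inner ℂ (gaborSystem G g p) y =
        gaborCoef gd ((unitCube d).indicator fun _ => 1) p.1 p.2 := by
      have : gaborSystem G g p = S (tfShift gd p.1 p.2) := by
        rw [frameOperator_tfShift hS, hgd]; rfl
      rw [this, hS.inner_left, hy]
      exact inner_gabor gd hf _ _
    have e2 : inner ℂ (modulateL2 (realVec (-(δ + δ))) (cubeL2 d)) (gaborSystem G g p) =
        conj (gaborCoef (modulateL2 (realVec (δ + δ)) g)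
          ((unitCube d).indicator fun _ => 1) p.1 p.2) := by
      rw [← inner_gabor _ hf, inner_conj_symm, ← inner_modulateL2 (realVec (δ + δ)),
        modulateL2_modulateL2, ← realVec_add, add_neg_cancel, realVec_zero, modulateL2_zero]
      change inner ℂ (cubeL2 d) (modulateL2 (realVec (δ + δ)) (tfShift g p.1 p.2)) = _
      rw [modulateL2_tfShift]
      rfl
    rw [e1, e2]

end Duality

/-! ### Real Fourier transform and reflection in the origin -/

section Reality

variable {d k : ℕ}

/-- The involution `f ↦ conj (f (-·))` of `L²(ℝᵈ)`. -/
noncomputable def conjReflect (f : L2 d) : L2 d :=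
  (Complex.conjCLE : ℂ →L[ℝ] ℂ).compLpL 2 volume
    (Lp.compMeasurePreserving (fun x => -x) (Measure.measurePreserving_neg volume) f)

theorem coeFn_conjReflect (f : L2 d) : conjReflect f =ᵐ[volume] fun x => conj (f (-x)) := by
  filter_upwards [ContinuousLinearMap.coeFn_compLpL (p := 2) (μ := volume)
    (Complex.conjCLE : ℂ →L[ℝ] ℂ)
    (Lp.compMeasurePreserving (fun x => -x) (Measure.measurePreserving_neg volume) f),
    Lp.coeFn_compMeasurePreserving f (Measure.measurePreserving_neg volume)] with x h1 h2
  rw [conjReflect, h1, h2]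
  rfl

theorem continuous_conjReflect : Continuous (conjReflect (d := d)) :=
  ((Complex.conjCLE : ℂ →L[ℝ] ℂ).compLpL 2 volume).continuous.comp
    (Lp.isometry_compMeasurePreserving _).continuous

/-- The Fourier transform intertwines `f ↦ conj (f (-·))` with complex conjugation. -/
theorem fourier_conjReflect (f : L2 d) :
    𝓕 (conjReflect f) = (Complex.conjCLE : ℂ →L[ℝ] ℂ).compLpL 2 volume (𝓕 f) := by
  have hd := SchwartzMap.denseRange_toLpCLM (E := EuclideanSpace ℝ (Fin d)) (F := ℂ) (p := 2)
    (μ := volume) (by norm_num)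
  have hc : Continuous (𝓕 : L2 d → L2 d) := (Lp.fourierTransformₗᵢ _ _).continuous
  refine congrFun (hd.equalizer (hc.comp continuous_conjReflect)
    (((Complex.conjCLE : ℂ →L[ℝ] ℂ).compLpL 2 volume).continuous.comp hc) (funext fun φ => ?_)) f
  simp only [Function.comp_apply, SchwartzMap.toLpCLM_apply]
  set φ' : SchwartzMap (EuclideanSpace ℝ (Fin d)) ℂ :=
    SchwartzMap.postcompCLM (Complex.conjCLE : ℂ →L[ℝ] ℂ)
      (SchwartzMap.compCLMOfContinuousLinearEquiv ℝ (ContinuousLinearEquiv.neg ℝ) φ) with hφ'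
  have hval : ∀ x, φ' x = conj (φ (-x)) := fun x => by
    simp [hφ']
  have h1 : conjReflect (φ.toLp 2) = φ'.toLp 2 := by
    have h0 : ∀ᵐ x : EuclideanSpace ℝ (Fin d), (φ.toLp 2 : L2 d) x = φ x := φ.coeFn_toLp 2 volume
    refine Lp.ext ?_
    filter_upwards [coeFn_conjReflect (φ.toLp 2), φ'.coeFn_toLp 2,
      (Measure.measurePreserving_neg volume).quasiMeasurePreserving.ae h0]
      with x h2 h3 h4
    rw [h2, h3, h4, hval]
  rw [h1, SchwartzMap.toLp_fourier_eq, SchwartzMap.toLp_fourier_eq]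
  refine Lp.ext ?_
  filter_upwards [(𝓕 φ').coeFn_toLp 2, (𝓕 φ).coeFn_toLp 2,
    ContinuousLinearMap.coeFn_compLpL (p := 2) (μ := volume) (Complex.conjCLE : ℂ →L[ℝ] ℂ)
      ((𝓕 φ).toLp 2)] with x h2 h3 h4
  rw [h2, h4, h3, SchwartzMap.fourier_coe, SchwartzMap.fourier_coe, Real.fourier_eq',
    Real.fourier_eq']
  change _ = conj _
  rw [← integral_conj, ← integral_neg_eq_self]
  refine integral_congr_ae (Filter.Eventually.of_forall fun v => ?_)
  simp only [hval, neg_neg, inner_neg_left, smul_eq_mul, map_mul, ← Complex.exp_conj,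
    Complex.conj_I, Complex.conj_ofReal]
  congr 2
  push_cast
  ring

/-- A function with real Fourier transform is conjugated by the reflection in the origin. -/
theorem neg_eq_conj_of_fourier_real {g : L2 d}
    (hreal : ∀ᵐ ω : EuclideanSpace ℝ (Fin d), (𝓕 g) ω = conj ((𝓕 g) ω)) :
    ∀ᵐ y, g (-y) = conj (g y) := by
  have h1 : 𝓕 (conjReflect g) = 𝓕 g := by
    rw [fourier_conjReflect]
    refine Lp.ext ?_
    filter_upwards [ContinuousLinearMap.coeFn_compLpL (p := 2) (μ := volume)
      (Complex.conjCLE : ℂ →L[ℝ] ℂ) (𝓕 g), hreal] with x h2 h3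
    rw [h2]
    exact h3.symm
  have h2 : conjReflect g = g := (Lp.fourierTransformₗᵢ _ _).injective h1
  have h3 := coeFn_conjReflect g
  rw [h2] at h3
  filter_upwards [h3] with y hy
  rw [hy, Complex.conj_conj]

end Reality

/-! ### The Riesz basis property -/

section RieszBasis

variable {d k : ℕ}

/-- If `w ≠ 0` then the signs are trivial on the stabiliser of `γ`: otherwise an element of the
stabiliser with sign `-1` would give `w = -w`. -/
theorem pairSign_eq_one_of_wilsonFun_ne_zero {G : AddSubgroup (Fin d → ZMod 2)}
    {s : Fin k → Fin d → ZMod 2} {rep : DualGroup G → Fin d → ℤ} {g : L2 d} {l : Fin d → ℤ} {h : G}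
    {γ : Fin d → ℤ} (hw : wilsonFun G s rep g l h γ ≠ 0) (ρ : G) (hρ : reflect ρ γ = γ) :
    pairSign (rep (dualHom G s h) + γ) ρ = 1 := by
  have : Fintype G := Fintype.ofFinite G
  refine (pairSign_eq_or _ _).resolve_right fun hneg => hw ?_
  rw [wilsonFun_eq, smul_eq_zero]
  right
  have eq_zero_of_eq_neg : ∀ x : L2 d, x = -x → x = 0 := fun x hx => by
    have h2 : (2 : ℂ) • x = 0 := by
      rw [two_smul]
      nth_rewrite 1 [hx]
      exact neg_add_cancel x
    exact (smul_eq_zero.1 h2).resolve_left two_ne_zero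
  refine eq_zero_of_eq_neg _ ?_
  conv_lhs => rw [← Equiv.sum_comp (Equiv.addRight ρ)]
  rw [← Finset.sum_neg_distrib]
  refine Finset.sum_congr rfl fun σ _ => ?_
  rw [Equiv.coe_addRight, AddSubgroup.coe_add, reflect_add, hρ, pairSign_add_right, hneg,
    mul_neg_one, neg_smul]

theorem inner_tfShift (u v : L2 d) (μ α β : Fin d → ℤ) :
    inner ℂ (tfShift u μ α) (tfShift v μ β) = inner ℂ (modulateL2 (realVec (α - β)) u) v := by
  rw [tfShift, tfShift, inner_translateL2, ← inner_modulateL2 (realVec β) _ v,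
    modulateL2_modulateL2, ← realVec_add, add_sub_cancel]

/-- Two reflections of an integer vector differ by an even vector. -/
theorem exists_reflect_sub (σ τ : Fin d → ZMod 2) (γ : Fin d → ℤ) :
    ∃ δ : Fin d → ℤ, reflect σ γ - reflect τ γ = δ + δ := by
  have h : ∀ j, ∃ m : ℤ, reflect σ γ j - reflect τ γ j = m + m := fun j => by
    have : Even (reflect σ γ j - reflect τ γ j) := by
      rw [← ZMod.intCast_eq_zero_iff_even]
      push_cast
      rw [intCast_reflect, intCast_reflect, sub_self]
    exact this
  choose δ hδ using h
  exact ⟨δ, funext hδ⟩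

/-- Non-zero Wilson functions are normalised against the Wilson functions of the canonical dual
window. -/
theorem inner_wilsonFun_dual {G : AddSubgroup (Fin d → ZMod 2)}
    {s : Fin k → Fin d → ZMod 2} (hG : IsSeparableGroup G s) {rep : DualGroup G → Fin d → ℤ}
    {g gd : L2 d} {S : L2 d →L[ℂ] L2 d}
    (hS : IsFrameOperator (gaborSystem G g) S) (hsurj : Function.Surjective S) (hgd : S gd = g)
    {l : Fin d → ℤ} {h : G} {γ : Fin d → ℤ} (hw : wilsonFun G s rep g l h γ ≠ 0) :
    inner ℂ (wilsonFun G s rep g l h γ) ((2 ^ k : ℂ) • wilsonFun G s rep gd l h γ) = 1 := by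
  classical
  have : Fintype G := Fintype.ofFinite G
  have hterm : ∀ σ τ : G, inner ℂ
      (pairSign (rep (dualHom G s h) + γ) σ •
        tfShift g (latticeEquiv G (l, h) : Fin d → ℤ) (reflect σ γ))
      (pairSign (rep (dualHom G s h) + γ) τ •
        tfShift gd (latticeEquiv G (l, h) : Fin d → ℤ) (reflect τ γ)) =
      if reflect (σ : Fin d → ZMod 2) γ = reflect (τ : Fin d → ZMod 2) γ then
        ((2 : ℂ) ^ k)⁻¹ else 0 := by
    intro σ τ
    obtain ⟨δ, hδ⟩ := exists_reflect_sub (σ : Fin d → ZMod 2) τ γ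
    rw [inner_smul_left, inner_smul_right, conj_pairSign, inner_tfShift, hδ,
      inner_modulate_dual hG hS hsurj hgd]
    have h0 : δ = 0 ↔ reflect (σ : Fin d → ZMod 2) γ = reflect (τ : Fin d → ZMod 2) γ := by
      rw [← sub_eq_zero (a := reflect (σ : Fin d → ZMod 2) γ), hδ]
      exact ⟨fun h => by simp [h], fun h => funext fun j => by
        have := congrFun h j
        simp at this
        omega⟩
    simp only [h0]
    split_ifs with hστ
    · have h1 := pairSign_eq_one_of_wilsonFun_ne_zero hw (τ + σ) (by
        rw [AddSubgroup.coe_add, reflect_add, hστ, reflect_reflect])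
      rw [AddSubgroup.coe_add, pairSign_add_right] at h1
      rw [← mul_assoc, mul_comm (pairSign _ (σ : Fin d → ZMod 2)), h1, one_mul]
    · simp
  rw [inner_smul_right, wilsonFun_eq, wilsonFun_eq, inner_smul_left, inner_smul_right,
    Complex.conj_ofReal, sum_inner]
  simp_rw [inner_sum, hterm]
  rw [← Finset.sum_product', Finset.univ_product_univ, ← Finset.sum_filter, Finset.sum_const,
    nsmul_eq_mul]
  have hcard := ncard_orbit_mul_card_pairs G γ
  rw [← Nat.card_eq_fintype_card, hG.card_eq] at hcard
  have hcard' := congrArg (Nat.cast : ℕ → ℂ) hcard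
  push_cast at hcard'
  have hwt : (wilsonWeight k G γ : ℂ) * (wilsonWeight k G γ : ℂ) =
      (((2 : ℂ) ^ k)⁻¹) ^ 2 * ((orbit G γ).ncard : ℂ) := by
    rw [← Complex.ofReal_mul, wilsonWeight, mul_mul_mul_comm,
      Real.mul_self_sqrt (Nat.cast_nonneg _)]
    push_cast
    ring
  have h2 : (2 : ℂ) ^ k ≠ 0 := pow_ne_zero _ two_ne_zero
  calc _ = ((wilsonWeight k G γ : ℂ) * (wilsonWeight k G γ : ℂ)) *
        ((Finset.univ.filter fun p : G × G =>
          reflect (p.1 : Fin d → ZMod 2) γ = reflect (p.2 : Fin d → ZMod 2) γ).card : ℂ) *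
        ((2 : ℂ) ^ k * ((2 : ℂ) ^ k)⁻¹) := by ring
    _ = (((2 : ℂ) ^ k)⁻¹) ^ 2 * ((2 : ℂ) ^ k * (2 : ℂ) ^ k) := by
        rw [hwt, mul_assoc ((((2 : ℂ) ^ k)⁻¹) ^ 2), hcard', mul_inv_cancel₀ h2, mul_one]
    _ = 1 := by field_simp

theorem frameOperator_wilsonFun {G : AddSubgroup (Fin d → ZMod 2)} {g : L2 d}
    {S : L2 d →L[ℂ] L2 d} (hS : IsFrameOperator (gaborSystem G g) S)
    (s : Fin k → Fin d → ZMod 2) (rep : DualGroup G → Fin d → ℤ) (f : L2 d) (l : Fin d → ℤ) (h : G)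
    (γ : Fin d → ℤ) : S (wilsonFun G s rep f l h γ) = wilsonFun G s rep (S f) l h γ := by
  have : Fintype G := Fintype.ofFinite G
  rw [wilsonFun_eq, wilsonFun_eq, map_smul, map_sum]
  simp only [map_smul, frameOperator_tfShift hS]

end RieszBasis

end WilsonSystems

theorem mainTheorem2 {d k : ℕ} (G : AddSubgroup (Fin d → ZMod 2)) (s : Fin k → Fin d → ZMod 2)
    (hG : IsSeparableGroup G s)
    (rep : DualGroup G → Fin d → ℤ) (hrep : ∀ q, QuotientAddGroup.mk (rep q) = q)
    (N : Set (Fin d → ℤ)) (hN : ∀ x : Fin d → ℤ, (N ∩ orbit G x).ncard = 1)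
    (g : L2 d) (hg : IsSeparableFun s g)
    (hreal : ∀ᵐ ω : EuclideanSpace ℝ (Fin d), (𝓕 g) ω = starRingEnd ℂ ((𝓕 g) ω)) :
    ((∀ b : ℝ, IsBessel (gaborSystem G g) b ↔
        IsBessel (wilsonSystem G s rep N g) (((2 : ℝ) ^ k)⁻¹ * b)) ∧
      (((∃ b, IsBessel (gaborSystem G g) b) ∨ ∃ b, IsBessel (wilsonSystem G s rep N g) b) →
        ∃ SG SW : L2 d →L[ℂ] L2 d,
          IsFrameOperator (gaborSystem G g) SG ∧
          IsFrameOperator (wilsonSystem G s rep N g) SW ∧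
          SG = (2 ^ k : ℂ) • SW)) ∧
    (∀ a b : ℝ, IsFrame (gaborSystem G g) a b ↔
      IsRieszBasis (wilsonSystem G s rep N g) (((2 : ℝ) ^ k)⁻¹ * a) (((2 : ℝ) ^ k)⁻¹ * b)) ∧
    (IsFrame (gaborSystem G g) (2 ^ k) (2 ^ k) ↔ IsONB (wilsonSystem G s rep N g)) := by
  have hE := isEnergyScaled_gabor_wilson hG hrep hN hg (neg_eq_conj_of_fourier_real hreal)
  have hD := dense_testFunctions (d := d)
  have hc : (0 : ℝ) < 2 ^ k := by positivity
  have hBessel := hE.isBessel_iff hD hc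
  have hop : ∀ {SG SW : L2 d →L[ℂ] L2 d}, IsFrameOperator (gaborSystem G g) SG →
      IsFrameOperator (wilsonSystem G s rep N g) SW → SG = (2 ^ k : ℂ) • SW := by
    intro SG SW h1 h2
    have := hE.frameOperator_eq hD hc h1 h2
    push_cast at this
    exact this
  have hRiesz : ∀ a b : ℝ, IsFrame (gaborSystem G g) a b ↔
      IsRieszBasis (wilsonSystem G s rep N g) (((2 : ℝ) ^ k)⁻¹ * a) (((2 : ℝ) ^ k)⁻¹ * b) := by
    intro a b
    refine ⟨fun h => ?_, fun h => (hE.isFrame_iff hD hc a b).2 h.isFrame⟩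
    have hW := (hE.isFrame_iff hD hc a b).1 h
    obtain ⟨S, hS⟩ := h.2.1.exists_frameOperator
    obtain ⟨T, hT⟩ := hW.2.1.exists_frameOperator
    have hsurj := h.frameOperator_surjective hS
    obtain ⟨gd, hgd⟩ := hsurj g
    refine hW.isRieszBasis hT
      (fun p => (2 ^ k : ℂ) • wilsonFun G s rep gd p.1.1 p.1.2.1 p.1.2.2) (fun p => ?_)
      fun p => inner_wilsonFun_dual hG hS hsurj hgd p.2
    rw [map_smul, ← smul_apply, ← hop hS hT, frameOperator_wilsonFun hS, hgd]
    rfl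
  refine ⟨⟨hBessel, fun h => ?_⟩, hRiesz, ?_⟩
  · have hG' : ∃ b, IsBessel (gaborSystem G g) b := by
      rcases h with h | ⟨b, hb⟩
      · exact h
      · exact ⟨2 ^ k * b, (hBessel _).2 (by rwa [inv_mul_cancel_left₀ hc.ne'])⟩
    obtain ⟨b, hb⟩ := hG'
    obtain ⟨SG, hSG⟩ := hb.exists_frameOperator
    obtain ⟨SW, hSW⟩ := ((hBessel b).1 hb).exists_frameOperator
    exact ⟨SG, SW, hSG, hSW, hop hSG hSW⟩
  · rw [hRiesz, inv_mul_cancel₀ hc.ne', isRieszBasis_one_iff_isONB]
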